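/- Let $M$ be a connected oriented smooth surface without boundary, and let $g,\hat g$ be smooth Riemannian metrics on $M$. Let $SM$ be the unit tangent bundle of $g$, let $J$ be the rotation by $\pi/2$ defined by $g$ and the orientation, let $X$ be the geodesic vector field of $g$ on $SM$, and let $V$ be the vertical vector field on $SM$, i.e. the generator of the flow $(x,v)\mapsto(x,\cos t\,v+\sin t\,Jv)$. A $1$-form $\theta$ on $M$ is also regarded as the function $(x,v)\mapsto\theta_x(v)$ on $SM$. Let $\theta,\alpha$ be smooth $1$-forms on $M$, let $a\in C^\infty(SM)$ be a real-valued function with $9a+VVa=0$ (equivalently, $a$ represents a cubic differential), put $\lambda=a-V\theta$, and let $F=X+\lambda V$ be the generator of the associated projective thermostat on $SM$. Let $$D={}^{\hat g}\nabla+\hat g\otimes\alpha^{\sharp}-\mathrm{Sym}(\alpha),\qquad \mathrm{Sym}(\alpha)(v,w)=\alpha(v)w+\alpha(w)v,$$ be the Weyl connection defined by $(\hat g,\alpha)$, where ${}^{\hat g}\nabla$ is the Levi-Civita connection of $\hat g$ and $\sharp$ is taken with respect to $\hat g$. Suppose that the thermostat and $D$ have the same unparametrised geodesics: the projection to $M$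 of every orbit of $F$ can be reparametrised to a geodesic of $D$, and every non-constant geodesic of $D$ can be reparametrised to the projection of an orbit of $F$. Define functions on $SM$ by $$p(x,v)=\hat g(v,v),\qquad r(x,v)=\hat g(v,Jv),\qquad q(x,v)=\hat g(Jv,Jv).$$ Then $$u=\frac32\log\!\left(\frac{p}{(pq-r^2)^{2/3}}\right)$$ is a smooth function on $SM$ and satisfies the transport equation $Fu=Va+\beta$ on $SM$, where $\beta=\theta-\alpha$. -/

import Mathlib

open scoped Manifold ContDiff Topology Bundle

noncomputable section
namespace Thermostat

/-! ### Oriented surfaces, metrics, one-forms, connections -/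

/-- The model plane `ℝ²`. -/
abbrev Plane : Type := EuclideanSpace ℝ (Fin 2)

section Surface
variable (M : Type*) [TopologicalSpace M] [ChartedSpace Plane M]

/-- The smooth surface `M` is oriented by its atlas: all transition maps have positive Jacobian
determinant. Tangent bases are then positive when they are positive in one (equivalently every)
chart. -/
class IsOrientedSurface : Prop where
  det_pos : ∀ e ∈ atlas Plane M, ∀ e' ∈ atlas Plane M, ∀ y ∈ (e.symm ≫ₕ e').source,
    0 < (fderiv ℝ (e.symm ≫ₕ e') y).det

variable [IsManifold (𝓡 2) ∞ M]

/-- Smooth Riemannian metrics on `M`. -/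
abbrev RiemMetric :=
  Bundle.ContMDiffRiemannianMetric (𝓡 2) ∞ Plane (fun x : M => TangentSpace (𝓡 2) x)

/-- Smooth one-forms on `M`. -/
abbrev OneForm :=
  ContMDiffSection (𝓡 2) (Plane →L[ℝ] ℝ) ∞ (fun x : M => TangentSpace (𝓡 2) x →L[ℝ] ℝ)

/-- Connections on `TM`; `D Y x v` is `D_v Y` at `x`. -/
abbrev Connection :=
  CovariantDerivative (𝓡 2) Plane (fun x : M => TangentSpace (𝓡 2) x)

end Surface

variable {M : Type*} [TopologicalSpace M] [ChartedSpace Plane M] [IsManifold (𝓡 2) ∞ M]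

instance (x : M) : FiniteDimensional ℝ (TangentSpace (𝓡 2) x) :=
  inferInstanceAs (FiniteDimensional ℝ Plane)

instance (x : M) : T2Space (TangentSpace (𝓡 2) x) :=
  inferInstanceAs (T2Space Plane)

theorem flat_bijective (g : RiemMetric M) (x : M) :
    Function.Bijective (g.inner x : TangentSpace (𝓡 2) x →ₗ[ℝ] TangentSpace (𝓡 2) x →L[ℝ] ℝ) := by
  have hinj : Function.Injective
      (g.inner x : TangentSpace (𝓡 2) x →ₗ[ℝ] TangentSpace (𝓡 2) x →L[ℝ] ℝ) := by
    rw [← LinearMap.ker_eq_bot, LinearMap.ker_eq_bot']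
    intro v hv
    by_contra h
    have h1 := g.pos x v h
    have h2 : g.inner x v = 0 := hv
    simp [h2] at h1
  refine ⟨hinj, ?_⟩
  refine (LinearMap.injective_iff_surjective_of_finrank_eq_finrank ?_).1 hinj
  rw [← (LinearMap.toContinuousLinearMap (𝕜 := ℝ) (E := TangentSpace (𝓡 2) x) (F' := ℝ)).finrank_eq]
  exact (Subspace.dual_finrank_eq (K := ℝ) (V := TangentSpace (𝓡 2) x)).symm

/-- The metric dual `η ↦ η^♯`, inverse to `v ↦ g(v, ·)`. -/
def sharp (g : RiemMetric M) (x : M) :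
    (TangentSpace (𝓡 2) x →L[ℝ] ℝ) ≃ₗ[ℝ] TangentSpace (𝓡 2) x :=
  (LinearEquiv.ofBijective
    (g.inner x : TangentSpace (𝓡 2) x →ₗ[ℝ] TangentSpace (𝓡 2) x →L[ℝ] ℝ)
    (flat_bijective g x)).symm

theorem inner_sharp (g : RiemMetric M) (x : M) (η : TangentSpace (𝓡 2) x →L[ℝ] ℝ)
    (w : TangentSpace (𝓡 2) x) : g.inner x (sharp g x η) w = η w :=
  congrArg (fun ζ : TangentSpace (𝓡 2) x →L[ℝ] ℝ => ζ w)
    ((LinearEquiv.ofBijective _ (flat_bijective g x)).apply_symm_apply η)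

/-! ### The rotation by `π/2`

`TangentSpace (𝓡 2) x` is `ℝ²`, through the derivative at `x` of the preferred chart at `x`, so on
an oriented surface the standard basis is a positive basis of it. -/

/-- Coordinates of a tangent vector at `x` in the preferred chart at `x`. -/
def coord {x : M} (v : TangentSpace (𝓡 2) x) (i : Fin 2) : ℝ := WithLp.ofLp (show Plane from v) i

/-- The coordinate basis of the tangent space at `x` for the preferred chart at `x`. -/
def frame (x : M) (i : Fin 2) : TangentSpace (𝓡 2) x := (EuclideanSpace.single i (1 : ℝ) : Plane)

/-- The coefficients `g_ij` of the metric at `x`, in the preferred chart at `x`. -/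
def gram (g : RiemMetric M) (x : M) (i j : Fin 2) : ℝ := g.inner x (frame x i) (frame x j)

/-- The determinant of `(g_ij)`. -/
def gramDet (g : RiemMetric M) (x : M) : ℝ := gram g x 0 0 * gram g x 1 1 - gram g x 0 1 ^ 2

/-- The complex structure `J` of `g` and the orientation: counter-clockwise rotation by `π/2`. -/
def rot (g : RiemMetric M) (x : M) (v : TangentSpace (𝓡 2) x) : TangentSpace (𝓡 2) x :=
  (√(gramDet g x))⁻¹ •
    (-(gram g x 0 1 * coord v 0 + gram g x 1 1 * coord v 1) • frame x 0 +
      (gram g x 0 0 * coord v 0 + gram g x 0 1 * coord v 1) • frame x 1)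

/-! ### The Levi-Civita connection and Weyl connections -/

section Algebra
variable {E : Type*} [NormedAddCommGroup E] [NormedSpace ℝ E]

set_option maxSynthPendingDepth 3 in
/-- `(v, w, z) ↦ (D_v(w,z) + D_w(v,z) - D_z(v,w)) / 2`. -/
def koszul (D : E →L[ℝ] E →L[ℝ] E →L[ℝ] ℝ) : E →L[ℝ] E →L[ℝ] E →L[ℝ] ℝ :=
  (1 / 2 : ℝ) • (D + D.flip -
    ((ContinuousLinearMap.flipₗᵢ ℝ E E ℝ).toContinuousLinearEquiv :
      (E →L[ℝ] E →L[ℝ] ℝ) →L[ℝ] (E →L[ℝ] E →L[ℝ] ℝ)) ∘L D.flip)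

set_option maxSynthPendingDepth 3 in
theorem koszul_apply (D : E →L[ℝ] E →L[ℝ] E →L[ℝ] ℝ) (v w z : E) :
    koszul D v w z = (D v w z + D w v z - D z v w) / 2 := by
  simp [koszul]
  ring

/-- `(v, w) ↦ S (K v w)`. -/
def raise (S : (E →L[ℝ] ℝ) →L[ℝ] E) (K : E →L[ℝ] E →L[ℝ] E →L[ℝ] ℝ) : E →L[ℝ] E →L[ℝ] E :=
  (ContinuousLinearMap.compL ℝ E (E →L[ℝ] ℝ) E S) ∘L K

end Algebra

/-- The coefficients of `g` at `y` (near `x`) in the preferred chart at `x`, as a bilinear form on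
`ℝ²`. -/
def metricCoord (g : RiemMetric M) (x y : M) : Plane →L[ℝ] Plane →L[ℝ] ℝ :=
  let s := (trivializationAt Plane (fun x : M => TangentSpace (𝓡 2) x) x).symmL ℝ y
  (s.precomp ℝ) ∘L (g.inner y) ∘L s

/-- The first derivatives at `x` of the coefficients of `g` in the preferred chart at `x`:
`dMetric g x v w z = ∂_v g(w, z)`. -/
def dMetric (g : RiemMetric M) (x : M) : Plane →L[ℝ] Plane →L[ℝ] Plane →L[ℝ] ℝ :=
  mfderiv (𝓡 2) 𝓘(ℝ, Plane →L[ℝ] Plane →L[ℝ] ℝ) (metricCoord g x) x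

/-- The Christoffel symbols `Γ(v, w)` of `g` at `x` in the preferred chart at `x`. -/
def christoffel (g : RiemMetric M) (x : M) :
    TangentSpace (𝓡 2) x →L[ℝ] TangentSpace (𝓡 2) x →L[ℝ] TangentSpace (𝓡 2) x :=
  raise (LinearMap.toContinuousLinearMap (sharp g x).toLinearMap : (Plane →L[ℝ] ℝ) →L[ℝ] Plane)
    (koszul (dMetric g x))

theorem christoffel_apply (g : RiemMetric M) (x : M) (v w : TangentSpace (𝓡 2) x) :
    christoffel g x v w = sharp g x (koszul (dMetric g x) v w) := rfl

/-- The derivative at `x` of the components of `Y` in the preferred chart at `x`. -/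
def coordDeriv (Y : ∀ x : M, TangentSpace (𝓡 2) x) (x : M) :
    TangentSpace (𝓡 2) x →L[ℝ] TangentSpace (𝓡 2) x :=
  mvfderiv (𝓡 2)
    (fun y => (trivializationAt Plane (fun x : M => TangentSpace (𝓡 2) x) x ⟨y, Y y⟩).2) x

theorem coordDeriv_isCov : IsCovariantDerivativeOn Plane
    (fun Y : (∀ x : M, TangentSpace (𝓡 2) x) => fun x => coordDeriv Y x) where
  add := by
    intro Y Y' x hY hY' _
    rw [mdifferentiableAt_section] at hY hY'
    refine Eq.trans ?_ (mvfderiv_add hY hY')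
    refine Filter.EventuallyEq.mfderiv_eq ?_
    filter_upwards [(trivializationAt Plane (fun x : M => TangentSpace (𝓡 2) x)
      x).open_baseSet.mem_nhds (FiberBundle.mem_baseSet_trivializationAt Plane _ x)] with y hy
    exact ((trivializationAt Plane (fun x : M => TangentSpace (𝓡 2) x) x).linear ℝ hy).map_add _ _
  leibniz := by
    intro Y f x hY hf _
    have hx : (trivializationAt Plane (fun x : M => TangentSpace (𝓡 2) x) x ⟨x, Y x⟩).2 = Y x :=
      tangentCoordChange_self (I := 𝓡 2) (v := Y x) (mem_extChartAt_source x)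
    rw [mdifferentiableAt_section] at hY
    refine Eq.trans ?_ ((mvfderiv_smul hf hY).trans ?_)
    · refine Filter.EventuallyEq.mfderiv_eq ?_
      filter_upwards [(trivializationAt Plane (fun x : M => TangentSpace (𝓡 2) x)
        x).open_baseSet.mem_nhds (FiberBundle.mem_baseSet_trivializationAt Plane _ x)] with y hy
      exact ((trivializationAt Plane (fun x : M => TangentSpace (𝓡 2) x) x).linear ℝ hy).map_smul
        _ _
    · rw [hx]; rfl

/-- The Levi-Civita connection of `g`: in the preferred chart at `x`, it is at `x` the sum of the
coordinate derivative and the Christoffel symbols. -/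
def leviCivita (g : RiemMetric M) : Connection M :=
  (⟨fun Y x => coordDeriv Y x, coordDeriv_isCov⟩ : Connection M).addOneForm (christoffel g)

/-- The tensor `g ⊗ α^♯ - Sym(α)`, where `Sym(α)(v, w) = α(v) w + α(w) v`. -/
def weylTensor (g : RiemMetric M) (α : OneForm M) (x : M) :
    TangentSpace (𝓡 2) x →L[ℝ] TangentSpace (𝓡 2) x →L[ℝ] TangentSpace (𝓡 2) x :=
  LinearMap.toContinuousLinearMap
    { toFun v := (g.inner x v).smulRight (sharp g x (α x)) - α x v • .id ℝ _ - (α x).smulRight v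
      map_add' v v' := by
        ext1 w; simp; module
      map_smul' c v := by
        ext1 w; simp; module }

theorem weylTensor_apply (g : RiemMetric M) (α : OneForm M) (x : M)
    (v w : TangentSpace (𝓡 2) x) :
    weylTensor g α x v w = g.inner x v w • sharp g x (α x) - (α x v • w + α x w • v) := by
  simp [weylTensor]
  abel

/-- The Weyl connection defined by `(g, α)`: `∇^g + g ⊗ α^♯ - Sym(α)`. -/
def weylConnection (g : RiemMetric M) (α : OneForm M) : Connection M :=
  (leviCivita g).addOneForm (weylTensor g α)

/-! ### Geodesics -/

/-- The geodesic spray of a connection, a vector field on `TM`. A tangent vector of `TM` at `(x, v)`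
is a pair `(ẋ, v̇)` in the chart of `TM` induced by the preferred chart at `x`; there the spray is
`ẋ = v`, `v̇ = -Γ(v, v)`, and `Γ(v, v) = D_v Y` for the vector field `Y` near `x` which has constant
components equal to those of `v`. -/
def geodesicSpray (D : Connection M) (ξ : TangentBundle (𝓡 2) M) :
    TangentSpace (𝓡 2).tangent ξ :=
  ((ξ.2, - D (FiberBundle.extend Plane ξ.2) ξ.1 ξ.2) : Plane × Plane)

/-- `c` is an (affinely parametrised) geodesic of `D` on the open set `s` of times: it lifts to an
integral curve of the geodesic spray. -/
def IsGeodesicOn (D : Connection M) (c : ℝ → M) (s : Set ℝ) : Prop :=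
  ∃ δ : ℝ → TangentBundle (𝓡 2) M,
    IsMIntegralCurveOn δ (geodesicSpray D) s ∧ ∀ t ∈ s, (δ t).proj = c t

/-- Non-empty open intervals, possibly unbounded. -/
def IsOpenInterval (s : Set ℝ) : Prop := IsOpen s ∧ s.OrdConnected ∧ s.Nonempty

/-- The curve `c₂` on `s₂` is a (smooth, regular) reparametrisation of the curve `c₁` on `s₁`. -/
def IsReparametrisation (c₁ : ℝ → M) (s₁ : Set ℝ) (c₂ : ℝ → M) (s₂ : Set ℝ) : Prop :=
  ∃ φ : ℝ → ℝ, ContDiffOn ℝ ∞ φ s₂ ∧ (∀ t ∈ s₂, deriv φ t ≠ 0) ∧ φ '' s₂ = s₁ ∧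
    ∀ t ∈ s₂, c₂ t = c₁ (φ t)

/-! ### The unit tangent bundle -/

/-- The unit tangent bundle `SM` of `g`. -/
def UnitTangent (g : RiemMetric M) : Type _ :=
  {ξ : TangentBundle (𝓡 2) M // g.inner ξ.1 ξ.2 ξ.2 = 1}

variable {g : RiemMetric M}

/-- `(x, v) ↦ (x, v / |v|_g)` for `v ≠ 0`. -/
def toUnit (g : RiemMetric M) (ξ : TangentBundle (𝓡 2) M) (h : ξ.2 ≠ 0) : UnitTangent g :=
  ⟨⟨ξ.1, (√(g.inner ξ.1 ξ.2 ξ.2))⁻¹ • ξ.2⟩, by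
    have h1 := g.pos ξ.1 ξ.2 h
    have h2 := Real.sq_sqrt h1.le
    have h3 := (Real.sqrt_pos.2 h1).ne'
    simp only [map_smul, smul_apply, smul_eq_mul]
    field_simp
    exact h2.symm⟩

open Classical in
/-- The extension of a function on `SM` which is constant along rays in `TM` minus the zero section
(and `0` on the zero section). -/
def radialExt (f : UnitTangent g → ℝ) (ξ : TangentBundle (𝓡 2) M) : ℝ :=
  if h : ξ.2 = 0 then 0 else f (toUnit g ξ h)

/-- `f ∈ C^∞(SM)`. As `(x, v) ↦ (x, v / |v|)` is a smooth retraction of `TM` minus the zero section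
onto `SM`, this says that the radial extension of `f` is smooth there. -/
def IsSmooth (f : UnitTangent g → ℝ) : Prop :=
  ContMDiffOn (𝓡 2).tangent 𝓘(ℝ, ℝ) ∞ (radialExt f) {ξ | ξ.2 ≠ 0}

/-- The derivative `W f` of a function on `SM` along a vector field on `TM` that is tangent to
`SM`. -/
def along (W : ∀ ξ : TangentBundle (𝓡 2) M, TangentSpace (𝓡 2).tangent ξ)
    (f : UnitTangent g → ℝ) (ξ : UnitTangent g) : ℝ :=
  mvfderiv (𝓡 2).tangent (radialExt f) ξ.1 (W ξ.1)

/-- The vertical vector field `V`, the generator of `t ↦ cos t • v + sin t • J v`. -/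
def verticalField (g : RiemMetric M) (ξ : TangentBundle (𝓡 2) M) : TangentSpace (𝓡 2).tangent ξ :=
  ((0, rot g ξ.1 ξ.2) : Plane × Plane)

/-- The geodesic vector field `X` of `g`. -/
def geodesicField (g : RiemMetric M) (ξ : TangentBundle (𝓡 2) M) : TangentSpace (𝓡 2).tangent ξ :=
  geodesicSpray (leviCivita g) ξ

/-- The generator `F = X + l V` of the thermostat of `(g, l)`. (Only its values along `SM`
matter.) -/
def thermostatField (g : RiemMetric M) (l : UnitTangent g → ℝ) (ξ : TangentBundle (𝓡 2) M) :
    TangentSpace (𝓡 2).tangent ξ :=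
  geodesicField g ξ + radialExt l ξ • verticalField g ξ

/-- `V f` for a function `f` on `SM`. -/
def vert (f : UnitTangent g → ℝ) : UnitTangent g → ℝ := along (verticalField g) f

/-- A one-form on `M`, thought of as the function `(x, v) ↦ θ_x(v)` on `SM`. -/
def formFun (g : RiemMetric M) (θ : OneForm M) (ξ : UnitTangent g) : ℝ := θ ξ.1.1 ξ.1.2

/-- `δ` is, on the set `s` of times, an orbit of the thermostat of `(g, l)`. -/
def IsThermostatOrbitOn (g : RiemMetric M) (l : UnitTangent g → ℝ) (δ : ℝ → UnitTangent g)
    (s : Set ℝ) : Prop :=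
  IsMIntegralCurveOn (fun t => (δ t).1) (thermostatField g l) s

/-- The thermostat of `(g, l)` and the connection `D` have the same unparametrised geodesics: up to
reparametrisation, the projections to `M` of the thermostat orbits are the non-constant geodesics
of `D`. -/
def SameUnparametrisedGeodesics (g : RiemMetric M) (l : UnitTangent g → ℝ) (D : Connection M) :
    Prop :=
  (∀ (δ : ℝ → UnitTangent g) (s : Set ℝ), IsOpenInterval s → IsThermostatOrbitOn g l δ s →
    ∃ (c : ℝ → M) (s' : Set ℝ), IsOpenInterval s' ∧ IsGeodesicOn D c s' ∧
      IsReparametrisation (fun t => (δ t).1.proj) s c s') ∧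
  (∀ (c : ℝ → M) (s : Set ℝ), IsOpenInterval s → IsGeodesicOn D c s →
    (∃ t ∈ s, ∃ t' ∈ s, c t ≠ c t') →
    ∃ (δ : ℝ → UnitTangent g) (s' : Set ℝ), IsOpenInterval s' ∧ IsThermostatOrbitOn g l δ s' ∧
      IsReparametrisation c s (fun t => (δ t).1.proj) s')

/-! ### The functions comparing two metrics -/

/-- `p(x, v) = ĝ(v, v)` on the unit tangent bundle of `g`. -/
def pFun (g gh : RiemMetric M) (ξ : UnitTangent g) : ℝ := gh.inner ξ.1.1 ξ.1.2 ξ.1.2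

/-- `r(x, v) = ĝ(v, J v)`. -/
def rFun (g gh : RiemMetric M) (ξ : UnitTangent g) : ℝ :=
  gh.inner ξ.1.1 ξ.1.2 (rot g ξ.1.1 ξ.1.2)

/-- `q(x, v) = ĝ(J v, J v)`. -/
def qFun (g gh : RiemMetric M) (ξ : UnitTangent g) : ℝ :=
  gh.inner ξ.1.1 (rot g ξ.1.1 ξ.1.2) (rot g ξ.1.1 ξ.1.2)

/-- `u = (3/2) log (p / (p q - r²)^(2/3))`. -/
def uFun (g gh : RiemMetric M) (ξ : UnitTangent g) : ℝ :=
  3 / 2 * Real.log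
    (pFun g gh ξ / (pFun g gh ξ * qFun g gh ξ - rFun g gh ξ ^ 2) ^ (2 / 3 : ℝ))

end Thermostat
end

open Thermostat

/-! The equation is pointwise once the geodesics have been traded for accelerations. For every unit
vector `v` there is a geodesic of `D` in direction `v`: by the transformation law of the Christoffel
symbols the spray of `D` is `C¹` in the charts of `TM` (`exists_geodesic`). By hypothesis it is
reparametrised by a thermostat orbit, which is therefore tangent to `±v`. Comparing second
derivatives in a chart (`exists_acceleration_eq`), and using that the geodesic curvature
`l = a - V θ` of thermostat orbits is odd in `v` (for `a` this follows from `V V a = -9 a`, see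
`cubic_neg`), one gets for all unit `v`

  `l(v) = g(Γ(v, v) - D_v v, J v)`,

where `Γ` are the Christoffel symbols of `g` (`curvature_eq`).

This identity is differentiated along the fibres of `SM`. The left-hand side gives
`V l = V a - V V θ = V a + θ`, as `V θ = θ ∘ J`. The right-hand side gives `F u + α`
(`hasDerivAt_curvature`). To see the latter, note that `p q - r²` is the ratio `det ĝ / det g` in
any coordinates, so that `u = (3/2) log ĝ(v, v) - (3/2) log g(v, v) - log det ĝ + log det g` extends
`u` to a function on `TM` which is constant along rays. As the Levi-Civita connections are metric and
`d log det` is twice the trace of the Christoffel symbols, `F u` is an expression in the Christoffel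
symbols of the two metrics only (`fderiv_uLocal`), and expanding it in the orthonormal frame
`v, J v` yields the claim. -/

noncomputable section
namespace Thermostat
variable {M : Type*} [TopologicalSpace M] [ChartedSpace Plane M] [IsManifold (𝓡 2) ∞ M]

/-! ### Metrics and one-forms in the preferred charts -/

/-- The transition map from the preferred chart at `x` to the preferred chart at `y`. -/
def trans (x y : M) : Plane → Plane := extChartAt (𝓡 2) y ∘ (extChartAt (𝓡 2) x).symm

theorem contDiffAt_trans {x y z : M} (hx : z ∈ (extChartAt (𝓡 2) x).source)
    (hy : z ∈ (extChartAt (𝓡 2) y).source) :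
    ContDiffAt ℝ ∞ (trans x y) (extChartAt (𝓡 2) x z) := by
  have h := contDiffWithinAt_ext_coord_change (I := 𝓡 2) (n := ∞) y x (y := extChartAt (𝓡 2) x z)
    (by
      rw [PartialEquiv.trans_source'', PartialEquiv.symm_symm, PartialEquiv.symm_target]
      exact Set.mem_image_of_mem _ ⟨hx, hy⟩)
  simpa [contDiffWithinAt_univ] using! h

theorem tangentCoordChange_eq {x y z : M} :
    tangentCoordChange (𝓡 2) x y z = fderiv ℝ (trans x y) (extChartAt (𝓡 2) x z) := by
  rw [tangentCoordChange_def]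
  simp [trans]

theorem extChartAt_tangent (ξ ζ : TangentBundle (𝓡 2) M) :
    extChartAt (𝓡 2).tangent ξ ζ =
      (extChartAt (𝓡 2) ξ.1 ζ.1, tangentCoordChange (𝓡 2) ζ.1 ξ.1 ζ.1 ζ.2) := rfl

theorem extChartAt_tangent_symm (ξ : TangentBundle (𝓡 2) M) (p : Plane × Plane) :
    (extChartAt (𝓡 2).tangent ξ).symm p =
      ⟨(extChartAt (𝓡 2) ξ.1).symm p.1, tangentCoordChange (𝓡 2) ξ.1
        ((extChartAt (𝓡 2) ξ.1).symm p.1) ((extChartAt (𝓡 2) ξ.1).symm p.1) p.2⟩ := rfl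

theorem extChartAt_tangent_self (ξ : TangentBundle (𝓡 2) M) :
    extChartAt (𝓡 2).tangent ξ ξ = (extChartAt (𝓡 2) ξ.1 ξ.1, ξ.2) := by
  exact Prod.ext rfl (tangentCoordChange_self (mem_extChartAt_source _))

/-- The coefficients of `g` in the preferred chart at `x`, as a function of the coordinates; they are
meaningless outside the target of the chart. -/
def metricLocal (g : RiemMetric M) (x : M) (p : Plane) : Plane →L[ℝ] Plane →L[ℝ] ℝ :=
  metricCoord g x ((extChartAt (𝓡 2) x).symm p)

theorem symmL_eq {x z : M} (hz : z ∈ (extChartAt (𝓡 2) x).source) :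
    (trivializationAt Plane (fun x : M => TangentSpace (𝓡 2) x) x).symmL ℝ z =
      tangentCoordChange (𝓡 2) x z z :=
  TangentBundle.symmL_trivializationAt_eq_core (by rwa [extChartAt_source] at hz)

theorem metricCoord_apply (g : RiemMetric M) {x z : M} (hz : z ∈ (extChartAt (𝓡 2) x).source)
    (v w : Plane) :
    metricCoord g x z v w = g.inner z (tangentCoordChange (𝓡 2) x z z v)
      (tangentCoordChange (𝓡 2) x z z w) := by
  rw [← symmL_eq hz]; rfl

theorem metricCoord_self (g : RiemMetric M) (x : M) : metricCoord g x x = g.inner x := by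
  ext v w
  rw [metricCoord_apply g (mem_extChartAt_source _),
    tangentCoordChange_self (mem_extChartAt_source _),
    tangentCoordChange_self (mem_extChartAt_source _)]
  rfl

theorem metricLocal_self (g : RiemMetric M) (x : M) :
    metricLocal g x (extChartAt (𝓡 2) x x) = g.inner x := by
  rw [metricLocal, extChartAt_to_inv, metricCoord_self]

/-- The coefficients of `θ` in the preferred chart at `x`, as a function of the coordinates; they are
meaningless outside the target of the chart. -/
def formLocal (θ : OneForm M) (x : M) (p : Plane) : Plane →L[ℝ] ℝ :=
  θ ((extChartAt (𝓡 2) x).symm p) ∘L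
    (trivializationAt Plane (fun x : M => TangentSpace (𝓡 2) x) x).symmL ℝ
      ((extChartAt (𝓡 2) x).symm p)

/-- The coordinate vector fields of a chart are smooth. -/
theorem contMDiffAt_frame (x : M) (w : Plane) {z : M} (hz : z ∈ (extChartAt (𝓡 2) x).source) :
    ContMDiffAt (𝓡 2) (𝓡 2).tangent ∞ (fun y => (⟨y,
      (trivializationAt Plane (fun x : M => TangentSpace (𝓡 2) x) x).symmL ℝ y w⟩ :
        TangentBundle (𝓡 2) M)) z := by
  have h := (trivializationAt Plane (fun x : M => TangentSpace (𝓡 2) x) x).contMDiffAt_symmL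
    (n := ∞) (IB := 𝓡 2) (x := z) (by simpa using hz)
  exact h.clm_bundle_apply (v := fun _ => w) (E₁ := fun _ : M => Plane) (F₁ := Plane) (by
    exact Bundle.contMDiffAt_section _ |>.2 contMDiffAt_const)

theorem contMDiffAt_metricCoord (g : RiemMetric M) {x z : M}
    (hz : z ∈ (extChartAt (𝓡 2) x).source) (v w : Plane) :
    ContMDiffAt (𝓡 2) 𝓘(ℝ, ℝ) ∞ (fun y => metricCoord g x y v w) z := by
  have h := (g.contMDiff z).clm_bundle_apply₂ (contMDiffAt_frame x v hz) (contMDiffAt_frame x w hz)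
    (E₃ := fun _ : M => ℝ) (F₃ := ℝ)
  exact (Bundle.contMDiffAt_section _).1 h

theorem contDiffAt_of_contMDiffAt {F : Type*} [NormedAddCommGroup F] [NormedSpace ℝ F] {x : M}
    {f : M → F} {p : Plane} (hp : p ∈ (extChartAt (𝓡 2) x).target)
    (hf : ContMDiffAt (𝓡 2) 𝓘(ℝ, F) ∞ f ((extChartAt (𝓡 2) x).symm p)) :
    ContDiffAt ℝ ∞ (fun q => f ((extChartAt (𝓡 2) x).symm q)) p := by
  have h : ContMDiffAt 𝓘(ℝ, Plane) (𝓡 2) ∞ (extChartAt (𝓡 2) x).symm p :=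
    (contMDiffOn_extChartAt_symm x).contMDiffAt ((isOpen_extChartAt_target x).mem_nhds hp)
  exact (hf.comp p h).contDiffAt

theorem contDiffOn_metricLocal (g : RiemMetric M) (x : M) :
    ContDiffOn ℝ ∞ (metricLocal g x) (extChartAt (𝓡 2) x).target := by
  rw [contDiffOn_clm_apply]
  intro v
  rw [contDiffOn_clm_apply]
  intro w p hp
  exact (contDiffAt_of_contMDiffAt (f := fun y => metricCoord g x y v w) hp
    (contMDiffAt_metricCoord g ((extChartAt (𝓡 2) x).map_target hp) v w)).contDiffWithinAt

theorem contDiffAt_metricLocal (g : RiemMetric M) {x : M} {p : Plane}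
    (hp : p ∈ (extChartAt (𝓡 2) x).target) : ContDiffAt ℝ ∞ (metricLocal g x) p :=
  (contDiffOn_metricLocal g x).contDiffAt ((isOpen_extChartAt_target x).mem_nhds hp)

theorem contDiffOn_formLocal (θ : OneForm M) (x : M) :
    ContDiffOn ℝ ∞ (formLocal θ x) (extChartAt (𝓡 2) x).target := by
  rw [contDiffOn_clm_apply]
  intro v p hp
  have hz := (extChartAt (𝓡 2) x).map_target hp
  have h := (θ.contMDiff_toFun _).clm_bundle_apply (contMDiffAt_frame x v hz)
    (E₂ := fun _ : M => ℝ) (F₂ := ℝ)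
  exact (contDiffAt_of_contMDiffAt (f := fun y => θ y
    ((trivializationAt Plane (fun x : M => TangentSpace (𝓡 2) x) x).symmL ℝ y v)) hp
    ((Bundle.contMDiffAt_section _).1 h)).contDiffWithinAt

theorem contDiffAt_formLocal (θ : OneForm M) {x : M} {p : Plane}
    (hp : p ∈ (extChartAt (𝓡 2) x).target) : ContDiffAt ℝ ∞ (formLocal θ x) p :=
  (contDiffOn_formLocal θ x).contDiffAt ((isOpen_extChartAt_target x).mem_nhds hp)

/-! ### Christoffel symbols and Weyl connections on a vector space -/

section Local
variable {E : Type*} [NormedAddCommGroup E] [NormedSpace ℝ E]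
variable {h k : E → E →L[ℝ] E →L[ℝ] ℝ} {a b : E → E →L[ℝ] ℝ} {τ : E → E} {p : E}

set_option maxSynthPendingDepth 3 in
/-- The first derivatives of the pullback of a metric by `τ`. -/
theorem fderiv_pullback_metric (hτ : ContDiffAt ℝ 2 τ p) (hk : DifferentiableAt ℝ k (τ p))
    (hh : DifferentiableAt ℝ h p)
    (hpull : ∀ᶠ q in 𝓝 p, ∀ v w, h q v w = k (τ q) (fderiv ℝ τ q v) (fderiv ℝ τ q w)) (z v w : E) :
    fderiv ℝ h p z v w =
      fderiv ℝ k (τ p) (fderiv ℝ τ p z) (fderiv ℝ τ p v) (fderiv ℝ τ p w) +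
      k (τ p) (fderiv ℝ (fderiv ℝ τ) p z v) (fderiv ℝ τ p w) +
      k (τ p) (fderiv ℝ τ p v) (fderiv ℝ (fderiv ℝ τ) p z w) := by
  have h2 : HasFDerivAt (fderiv ℝ τ) (fderiv ℝ (fderiv ℝ τ) p) p :=
    ((hτ.fderiv_right (m := 1) (by norm_num)).differentiableAt one_ne_zero).hasFDerivAt
  have hT : HasFDerivAt τ (fderiv ℝ τ p) p := (hτ.differentiableAt two_ne_zero).hasFDerivAt
  have h3 (u : E) : HasFDerivAt (fun q => fderiv ℝ τ q u) _ p :=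
    h2.clm_apply (hasFDerivAt_const u p)
  have h4 := ((hk.hasFDerivAt.comp p hT).clm_apply (h3 v)).clm_apply (h3 w)
  have h5 : HasFDerivAt (fun q => h q v w) _ p :=
    (hh.hasFDerivAt.clm_apply (hasFDerivAt_const v p)).clm_apply (hasFDerivAt_const w p)
  have h6 := h5.unique (h4.congr_of_eventuallyEq (hpull.mono fun q hq => hq v w))
  have h7 := DFunLike.congr_fun h6 z
  simp at h7
  rw [h7]
  ring

set_option maxSynthPendingDepth 3 in
/-- On the diagonal, `koszul` is a composition of maps that are visibly smooth in `D`. -/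
theorem koszul_diagonal (D : E →L[ℝ] E →L[ℝ] E →L[ℝ] ℝ) (v : E) :
    koszul D v v = D v v - (1 / 2 : ℝ) • (D.flip v).flip v := by
  ext z
  simp only [koszul_apply, sub_apply, smul_apply, ContinuousLinearMap.flip_apply, smul_eq_mul]
  ring

variable [FiniteDimensional ℝ E]

theorem exists_equiv_of_pos {B : E →L[ℝ] E →L[ℝ] ℝ} (hB : ∀ v, v ≠ 0 → 0 < B v v) :
    ∃ e : E ≃L[ℝ] (E →L[ℝ] ℝ), (e : E →L[ℝ] E →L[ℝ] ℝ) = B := by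
  have hinj : Function.Injective (B : E →ₗ[ℝ] E →L[ℝ] ℝ) := by
    rw [← LinearMap.ker_eq_bot, LinearMap.ker_eq_bot']
    intro v hv
    by_contra h
    have h1 := hB v h
    have h2 : B v = 0 := hv
    simp [h2] at h1
  have hfr : Module.finrank ℝ E = Module.finrank ℝ (E →L[ℝ] ℝ) := by
    rw [← (LinearMap.toContinuousLinearMap (𝕜 := ℝ) (E := E) (F' := ℝ)).finrank_eq]
    exact (Subspace.dual_finrank_eq (K := ℝ) (V := E)).symm
  refine ⟨(LinearEquiv.ofInjectiveOfFinrankEq _ hinj hfr).toContinuousLinearEquiv, ?_⟩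
  ext v w
  rfl

theorem apply_inverse_of_pos {B : E →L[ℝ] E →L[ℝ] ℝ} (hB : ∀ v, v ≠ 0 → 0 < B v v)
    (η : E →L[ℝ] ℝ) : B (B.inverse η) = η := by
  obtain ⟨e, rfl⟩ := exists_equiv_of_pos hB
  simp

theorem injective_of_pos {B : E →L[ℝ] E →L[ℝ] ℝ} (hB : ∀ v, v ≠ 0 → 0 < B v v) {v w : E}
    (h : B v = B w) : v = w := by
  obtain ⟨e, rfl⟩ := exists_equiv_of_pos hB
  exact e.injective h

/-- The Christoffel symbols of a metric `h` on a domain of a vector space. -/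
def christoffelLocal (h : E → E →L[ℝ] E →L[ℝ] ℝ) (p : E) (v w : E) : E :=
  (h p).inverse (koszul (fderiv ℝ h p) v w)

/-- The quadratic form `D_v v` of the Weyl connection `D` of `(h, a)` on a domain of a vector
space. -/
def weylLocal (h : E → E →L[ℝ] E →L[ℝ] ℝ) (a : E → E →L[ℝ] ℝ) (p : E) (v : E) : E :=
  christoffelLocal h p v v + (h p v v • (h p).inverse (a p) - (2 * a p v) • v)

/-- The transformation law of the Christoffel symbols. -/
theorem christoffelLocal_pullback (hτ : ContDiffAt ℝ 2 τ p) (hk : DifferentiableAt ℝ k (τ p))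
    (hh : DifferentiableAt ℝ h p)
    (hpull : ∀ᶠ q in 𝓝 p, ∀ v w, h q v w = k (τ q) (fderiv ℝ τ q v) (fderiv ℝ τ q w))
    (hsurj : Function.Surjective (fderiv ℝ τ p)) (hhp : ∀ v, v ≠ 0 → 0 < h p v v)
    (hkp : ∀ v, v ≠ 0 → 0 < k (τ p) v v) (hks : ∀ v w, k (τ p) v w = k (τ p) w v) (v w : E) :
    fderiv ℝ τ p (christoffelLocal h p v w) = fderiv ℝ (fderiv ℝ τ) p v w +
      christoffelLocal k (τ p) (fderiv ℝ τ p v) (fderiv ℝ τ p w) := by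
  apply injective_of_pos hkp
  ext z'
  obtain ⟨z, rfl⟩ := hsurj z'
  have hsymm : IsSymmSndFDerivAt ℝ τ p := hτ.isSymmSndFDerivAt (by simp)
  rw [← hpull.self_of_nhds]
  simp only [map_add, add_apply, christoffelLocal, apply_inverse_of_pos hhp,
    apply_inverse_of_pos hkp, koszul_apply, fderiv_pullback_metric hτ hk hh hpull]
  rw [hsymm.eq w v, hsymm.eq z v, hsymm.eq z w, hks (fderiv ℝ τ p w),
    hks (fderiv ℝ τ p v) (fderiv ℝ (fderiv ℝ τ) p w z)]
  ring

/-- The transformation law of `D_v v`: the tensor part of the connection is natural, so the second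
derivative of `τ` enters as for the Christoffel symbols. -/
theorem weylLocal_pullback (hτ : ContDiffAt ℝ 2 τ p) (hk : DifferentiableAt ℝ k (τ p))
    (hh : DifferentiableAt ℝ h p)
    (hpull : ∀ᶠ q in 𝓝 p, ∀ v w, h q v w = k (τ q) (fderiv ℝ τ q v) (fderiv ℝ τ q w))
    (hab : ∀ v, a p v = b (τ p) (fderiv ℝ τ p v))
    (hsurj : Function.Surjective (fderiv ℝ τ p)) (hhp : ∀ v, v ≠ 0 → 0 < h p v v)
    (hkp : ∀ v, v ≠ 0 → 0 < k (τ p) v v) (hks : ∀ v w, k (τ p) v w = k (τ p) w v) (v : E) :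
    fderiv ℝ τ p (weylLocal h a p v) = fderiv ℝ (fderiv ℝ τ) p v v +
      weylLocal k b (τ p) (fderiv ℝ τ p v) := by
  have h1 : fderiv ℝ τ p ((h p).inverse (a p)) = (k (τ p)).inverse (b (τ p)) := by
    apply injective_of_pos hkp
    ext z'
    obtain ⟨z, rfl⟩ := hsurj z'
    rw [← hpull.self_of_nhds, apply_inverse_of_pos hhp, apply_inverse_of_pos hkp, hab]
  simp only [weylLocal, map_add, map_sub, map_smul, h1,
    christoffelLocal_pullback hτ hk hh hpull hsurj hhp hkp hks, hab, hpull.self_of_nhds]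
  abel

set_option maxSynthPendingDepth 3 in
theorem contDiffAt_weylLocal {v : E} (hh : ContDiffAt ℝ ∞ h p) (ha : ContDiffAt ℝ ∞ a p)
    (hhp : ∀ v, v ≠ 0 → 0 < h p v v) :
    ContDiffAt ℝ 1 (fun q : E × E => weylLocal h a q.1 q.2) (p, v) := by
  have hh1 : ContDiffAt ℝ 1 (fun q : E × E => h q.1) (p, v) :=
    (hh.of_le (by simp)).comp (p, v) contDiffAt_fst
  have ha1 : ContDiffAt ℝ 1 (fun q : E × E => a q.1) (p, v) :=
    (ha.of_le (by simp)).comp (p, v) contDiffAt_fst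
  have hd1 : ContDiffAt ℝ 1 (fun q : E × E => fderiv ℝ h q.1) (p, v) :=
    (hh.fderiv_right (m := 1) (by rw [one_add_one_eq_two]; exact WithTop.coe_le_coe.2 le_top)).comp
      (p, v) contDiffAt_fst
  have hi : ContDiffAt ℝ 1 (fun q : E × E => (h q.1).inverse) (p, v) := by
    obtain ⟨e, he⟩ := exists_equiv_of_pos hhp
    have h2 := contDiffAt_map_inverse (𝕜 := ℝ) (n := 1) e
    rw [he] at h2
    exact h2.comp (p, v) hh1
  have hv : ContDiffAt ℝ 1 (fun q : E × E => q.2) (p, v) := contDiffAt_snd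
  have hK : ContDiffAt ℝ 1 (fun q : E × E => koszul (fderiv ℝ h q.1) q.2 q.2) (p, v) := by
    simp only [koszul_diagonal]
    have hf : ContDiffAt ℝ 1 (fun q : E × E => (fderiv ℝ h q.1).flip) (p, v) :=
      (ContinuousLinearMap.flipₗᵢ ℝ E E (E →L[ℝ] ℝ)).toContinuousLinearEquiv.contDiff.contDiffAt
        |>.comp (p, v) hd1
    have hf2 : ContDiffAt ℝ 1 (fun q : E × E => ((fderiv ℝ h q.1).flip q.2).flip) (p, v) :=
      (ContinuousLinearMap.flipₗᵢ ℝ E E ℝ).toContinuousLinearEquiv.contDiff.contDiffAt.comp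
        (p, v) (hf.clm_apply hv)
    exact ((hd1.clm_apply hv).clm_apply hv).sub ((hf2.clm_apply hv).const_smul (1 / 2 : ℝ))
  exact (hi.clm_apply hK).add ((((hh1.clm_apply hv).clm_apply hv).smul (hi.clm_apply ha1)).sub
    ((contDiffAt_const.mul (ha1.clm_apply hv)).smul hv))

end Local

/-! ### Change of charts -/

theorem tangentCoordChange_injective {x z : M} (hz : z ∈ (extChartAt (𝓡 2) x).source) {v : Plane}
    (h : tangentCoordChange (𝓡 2) x z z v = 0) : v = 0 := by
  rw [← tangentCoordChange_self (I := 𝓡 2) (v := v) hz,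
    ← tangentCoordChange_comp (x := z) ⟨⟨hz, mem_extChartAt_source z⟩, hz⟩, h, map_zero]

theorem metricLocal_apply (g : RiemMetric M) {x : M} {p : Plane}
    (hp : p ∈ (extChartAt (𝓡 2) x).target) (v w : Plane) :
    metricLocal g x p v w = g.inner ((extChartAt (𝓡 2) x).symm p)
      (tangentCoordChange (𝓡 2) x ((extChartAt (𝓡 2) x).symm p) ((extChartAt (𝓡 2) x).symm p) v)
      (tangentCoordChange (𝓡 2) x ((extChartAt (𝓡 2) x).symm p)
        ((extChartAt (𝓡 2) x).symm p) w) :=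
  metricCoord_apply g ((extChartAt (𝓡 2) x).map_target hp) v w

theorem formLocal_apply (θ : OneForm M) {x : M} {p : Plane}
    (hp : p ∈ (extChartAt (𝓡 2) x).target) (v : Plane) :
    formLocal θ x p v = θ ((extChartAt (𝓡 2) x).symm p)
      (tangentCoordChange (𝓡 2) x ((extChartAt (𝓡 2) x).symm p)
        ((extChartAt (𝓡 2) x).symm p) v) := by
  rw [← symmL_eq ((extChartAt (𝓡 2) x).map_target hp)]; rfl

theorem formLocal_self (θ : OneForm M) (x : M) :
    formLocal θ x (extChartAt (𝓡 2) x x) = θ x := by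
  ext v
  have h : (extChartAt (𝓡 2) x).symm (extChartAt (𝓡 2) x x) = x := extChartAt_to_inv x
  rw [formLocal_apply θ (mem_extChartAt_target x), h,
    tangentCoordChange_self (mem_extChartAt_source x)]
  rfl

theorem metricLocal_pos (g : RiemMetric M) {x : M} {p : Plane}
    (hp : p ∈ (extChartAt (𝓡 2) x).target) (v : Plane) (hv : v ≠ 0) :
    0 < metricLocal g x p v v := by
  rw [metricLocal_apply g hp]
  exact g.pos _ _ fun h => hv (tangentCoordChange_injective ((extChartAt (𝓡 2) x).map_target hp) h)

theorem metricLocal_symm (g : RiemMetric M) (x : M) (p v w : Plane) :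
    metricLocal g x p v w = metricLocal g x p w v :=
  g.symm _ _ _

omit [IsManifold (𝓡 2) ∞ M] in
theorem trans_apply {x y z : M} (hx : z ∈ (extChartAt (𝓡 2) x).source) :
    trans x y (extChartAt (𝓡 2) x z) = extChartAt (𝓡 2) y z := by
  simp only [trans, Function.comp_apply]
  rw [(extChartAt (𝓡 2) x).left_inv hx]

omit [IsManifold (𝓡 2) ∞ M] in
theorem eventually_chart {x y z : M} (hx : z ∈ (extChartAt (𝓡 2) x).source)
    (hy : z ∈ (extChartAt (𝓡 2) y).source) :
    ∀ᶠ p in 𝓝 (extChartAt (𝓡 2) x z), ∃ z', z' ∈ (extChartAt (𝓡 2) x).source ∧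
      z' ∈ (extChartAt (𝓡 2) y).source ∧ extChartAt (𝓡 2) x z' = p := by
  have h1 := (isOpen_extChartAt_target (I := 𝓡 2) x).mem_nhds ((extChartAt (𝓡 2) x).map_source hx)
  have h2 : ContinuousAt (extChartAt (𝓡 2) x).symm (extChartAt (𝓡 2) x z) :=
    continuousAt_extChartAt_symm' hx
  have h3 := (isOpen_extChartAt_source (I := 𝓡 2) y).mem_nhds hy
  rw [← (extChartAt (𝓡 2) x).left_inv hx] at h3
  filter_upwards [h1, h2 h3] with p hp hp'
  exact ⟨_, (extChartAt (𝓡 2) x).map_target hp, hp', (extChartAt (𝓡 2) x).right_inv hp⟩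

theorem metricLocal_trans (g : RiemMetric M) {x y z : M} (hx : z ∈ (extChartAt (𝓡 2) x).source)
    (hy : z ∈ (extChartAt (𝓡 2) y).source) (v w : Plane) :
    metricLocal g x (extChartAt (𝓡 2) x z) v w =
      metricLocal g y (trans x y (extChartAt (𝓡 2) x z))
        (fderiv ℝ (trans x y) (extChartAt (𝓡 2) x z) v)
        (fderiv ℝ (trans x y) (extChartAt (𝓡 2) x z) w) := by
  rw [trans_apply hx, ← tangentCoordChange_eq]
  simp only [metricLocal]
  rw [(extChartAt (𝓡 2) x).left_inv hx, (extChartAt (𝓡 2) y).left_inv hy,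
    metricCoord_apply g hx, metricCoord_apply g hy,
    tangentCoordChange_comp ⟨⟨hx, hy⟩, mem_extChartAt_source z⟩,
    tangentCoordChange_comp ⟨⟨hx, hy⟩, mem_extChartAt_source z⟩]

theorem formLocal_trans (θ : OneForm M) {x y z : M} (hx : z ∈ (extChartAt (𝓡 2) x).source)
    (hy : z ∈ (extChartAt (𝓡 2) y).source) (v : Plane) :
    formLocal θ x (extChartAt (𝓡 2) x z) v =
      formLocal θ y (trans x y (extChartAt (𝓡 2) x z))
        (fderiv ℝ (trans x y) (extChartAt (𝓡 2) x z) v) := by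
  rw [trans_apply hx, ← tangentCoordChange_eq,
    formLocal_apply _ ((extChartAt (𝓡 2) x).map_source hx),
    formLocal_apply _ ((extChartAt (𝓡 2) y).map_source hy)]
  rw [(extChartAt (𝓡 2) x).left_inv hx, (extChartAt (𝓡 2) y).left_inv hy,
    tangentCoordChange_comp ⟨⟨hx, hy⟩, mem_extChartAt_source z⟩]

theorem eventually_metricLocal_trans (g : RiemMetric M) {x y z : M}
    (hx : z ∈ (extChartAt (𝓡 2) x).source) (hy : z ∈ (extChartAt (𝓡 2) y).source) :
    ∀ᶠ p in 𝓝 (extChartAt (𝓡 2) x z), ∀ v w, metricLocal g x p v w =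
      metricLocal g y (trans x y p) (fderiv ℝ (trans x y) p v) (fderiv ℝ (trans x y) p w) := by
  filter_upwards [eventually_chart hx hy] with p hp
  obtain ⟨z', hx', hy', rfl⟩ := hp
  exact metricLocal_trans g hx' hy'

theorem surjective_fderiv_trans {x y z : M} (hx : z ∈ (extChartAt (𝓡 2) x).source)
    (hy : z ∈ (extChartAt (𝓡 2) y).source) :
    Function.Surjective (fderiv ℝ (trans x y) (extChartAt (𝓡 2) x z)) := by
  intro w
  refine ⟨tangentCoordChange (𝓡 2) y x z w, ?_⟩
  rw [← tangentCoordChange_eq, tangentCoordChange_comp ⟨⟨hy, hx⟩, hy⟩, tangentCoordChange_self hy]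

omit [IsManifold (𝓡 2) ∞ M] in
/-- The derivative at `x` of a map given by `h` in the preferred chart at `x`. -/
theorem hasMFDerivAt_of_chart {F : Type*} [NormedAddCommGroup F] [NormedSpace ℝ F] {x : M}
    {f : M → F} {h : Plane → F} {h' : Plane →L[ℝ] F}
    (hf : ∀ y ∈ (extChartAt (𝓡 2) x).source, f y = h (extChartAt (𝓡 2) x y))
    (hh : HasFDerivAt h h' (extChartAt (𝓡 2) x x)) :
    HasMFDerivAt (𝓡 2) 𝓘(ℝ, F) f x h' := by
  refine ⟨?_, ?_⟩
  · refine (hh.continuousAt.comp (f := extChartAt (𝓡 2) x) (continuousAt_extChartAt x)).congr ?_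
    filter_upwards [extChartAt_source_mem_nhds (I := 𝓡 2) x] with y hy using (hf y hy).symm
  · refine (hh.congr_of_eventuallyEq ?_).hasFDerivWithinAt
    filter_upwards [extChartAt_target_mem_nhds (I := 𝓡 2) x] with p hp
    have h1 := hf _ ((extChartAt (𝓡 2) x).map_target hp)
    rwa [(extChartAt (𝓡 2) x).right_inv hp] at h1

set_option maxSynthPendingDepth 3 in
theorem dMetric_eq (g : RiemMetric M) (x : M) :
    dMetric g x = fderiv ℝ (metricLocal g x) (extChartAt (𝓡 2) x x) := by
  refine (hasMFDerivAt_of_chart (fun y hy => ?_) ((contDiffAt_metricLocal g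
    (mem_extChartAt_target x)).differentiableAt (by simp)).hasFDerivAt).mfderiv
  rw [metricLocal, (extChartAt (𝓡 2) x).left_inv hy]

/-- The extension of `v` used in `geodesicSpray` has constant components. -/
theorem coordDeriv_extend {x : M} (v : TangentSpace (𝓡 2) x) :
    coordDeriv (FiberBundle.extend Plane v) x = 0 := by
  have h : (fun y => (trivializationAt Plane (fun x : M => TangentSpace (𝓡 2) x) x
      ⟨y, FiberBundle.extend Plane v y⟩).2) =ᶠ[𝓝 x] fun _ =>
        (trivializationAt Plane (fun x : M => TangentSpace (𝓡 2) x) x ⟨x, v⟩).2 := by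
    filter_upwards [(trivializationAt Plane (fun x : M => TangentSpace (𝓡 2) x)
      x).open_baseSet.mem_nhds (FiberBundle.mem_baseSet_trivializationAt Plane _ x)] with y hy
    exact (congrArg Prod.snd (Bundle.Trivialization.apply_mk_symm _ hy
      (trivializationAt Plane (fun x : M => TangentSpace (𝓡 2) x) x ⟨x, v⟩).2) :)
  exact h.mfderiv_eq.trans (mfderiv_const)

theorem sharp_eq (g : RiemMetric M) (x : M) (η : Plane →L[ℝ] ℝ) :
    sharp g x η = (metricLocal g x (extChartAt (𝓡 2) x x)).inverse η := by
  have hpos := metricLocal_pos g (mem_extChartAt_target x)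
  apply injective_of_pos hpos
  rw [apply_inverse_of_pos hpos, metricLocal_self]
  ext w
  exact inner_sharp g x η w

theorem christoffel_eq (g : RiemMetric M) (x : M) (v w : TangentSpace (𝓡 2) x) :
    christoffel g x v w = christoffelLocal (metricLocal g x) (extChartAt (𝓡 2) x x) v w := by
  rw [christoffel_apply, sharp_eq, dMetric_eq]
  rfl

theorem leviCivita_extend (g : RiemMetric M) (x : M) (v : TangentSpace (𝓡 2) x) :
    leviCivita g (FiberBundle.extend Plane v) x v =
      christoffelLocal (metricLocal g x) (extChartAt (𝓡 2) x x) v v := by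
  have h : leviCivita g (FiberBundle.extend Plane v) x v =
    coordDeriv (FiberBundle.extend Plane v) x v +
      christoffel g x (FiberBundle.extend Plane v x) v := rfl
  rw [h, coordDeriv_extend, FiberBundle.extend_apply_self, christoffel_eq]
  exact zero_add _

theorem weylTensor_eq (g : RiemMetric M) (α : OneForm M) (x : M) (v : TangentSpace (𝓡 2) x) :
    weylTensor g α x v v = metricLocal g x (extChartAt (𝓡 2) x x) v v •
      (metricLocal g x (extChartAt (𝓡 2) x x)).inverse (formLocal α x (extChartAt (𝓡 2) x x)) -
      (2 * formLocal α x (extChartAt (𝓡 2) x x) v) • (show Plane from v) := by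
  have h : sharp g x (α x) =
      (metricLocal g x (extChartAt (𝓡 2) x x)).inverse (formLocal α x (extChartAt (𝓡 2) x x)) := by
    rw [formLocal_self]
    exact sharp_eq g x (α x)
  rw [weylTensor_apply, h, two_mul, add_smul, formLocal_self]
  rw [metricLocal_self]
  rfl

theorem weylConnection_extend (g : RiemMetric M) (α : OneForm M) (x : M)
    (v : TangentSpace (𝓡 2) x) :
    weylConnection g α (FiberBundle.extend Plane v) x v =
      weylLocal (metricLocal g x) (formLocal α x) (extChartAt (𝓡 2) x x) v := by
  have h : weylConnection g α (FiberBundle.extend Plane v) x v =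
    leviCivita g (FiberBundle.extend Plane v) x v +
      weylTensor g α x (FiberBundle.extend Plane v x) v := rfl
  rw [h, FiberBundle.extend_apply_self, leviCivita_extend, weylTensor_eq]
  rfl

theorem geodesicSpray_leviCivita (g : RiemMetric M) (ξ : TangentBundle (𝓡 2) M) :
    geodesicSpray (leviCivita g) ξ =
      ((ξ.2, -christoffelLocal (metricLocal g ξ.1) (extChartAt (𝓡 2) ξ.1 ξ.1) ξ.2 ξ.2) :
        Plane × Plane) :=
  Prod.ext rfl (congrArg Neg.neg (leviCivita_extend g ξ.1 ξ.2))

theorem geodesicSpray_weylConnection (g : RiemMetric M) (α : OneForm M)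
    (ξ : TangentBundle (𝓡 2) M) :
    geodesicSpray (weylConnection g α) ξ =
      ((ξ.2, -weylLocal (metricLocal g ξ.1) (formLocal α ξ.1) (extChartAt (𝓡 2) ξ.1 ξ.1) ξ.2) :
        Plane × Plane) :=
  Prod.ext rfl (congrArg Neg.neg (weylConnection_extend g α ξ.1 ξ.2))

/-! ### Existence of Weyl geodesics -/

/-- Transition maps of the tangent bundle act by the derivative of those of the base. -/
theorem tangent_trans_eventuallyEq {ξ ζ : TangentBundle (𝓡 2) M}
    (h : ξ.1 ∈ (extChartAt (𝓡 2) ζ.1).source) :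
    extChartAt (𝓡 2).tangent ζ ∘ (extChartAt (𝓡 2).tangent ξ).symm
      =ᶠ[𝓝 (extChartAt (𝓡 2).tangent ξ ξ)]
      fun q : Plane × Plane => (trans ξ.1 ζ.1 q.1, fderiv ℝ (trans ξ.1 ζ.1) q.1 q.2) := by
  have h1 : ∀ᶠ q : Plane × Plane in 𝓝 (extChartAt (𝓡 2).tangent ξ ξ),
      ∃ z', z' ∈ (extChartAt (𝓡 2) ξ.1).source ∧
      z' ∈ (extChartAt (𝓡 2) ζ.1).source ∧ extChartAt (𝓡 2) ξ.1 z' = q.1 := by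
    rw [extChartAt_tangent_self]
    exact (continuous_fst.tendsto ((extChartAt (𝓡 2) ξ.1 ξ.1, ξ.2) : Plane × Plane)).eventually
      (eventually_chart (mem_extChartAt_source ξ.1) h)
  filter_upwards [h1] with q hq
  obtain ⟨p, w⟩ := q
  obtain ⟨z', hx, hy, rfl⟩ := hq
  simp only [Function.comp_apply, extChartAt_tangent_symm, extChartAt_tangent]
  rw [(extChartAt (𝓡 2) ξ.1).left_inv hx, tangentCoordChange_comp
    ⟨⟨hx, mem_extChartAt_source z'⟩, hy⟩, trans_apply hx, tangentCoordChange_eq]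

/-- The derivative of a transition map of the tangent bundle. -/
theorem hasFDerivAt_tangent_trans {ξ ζ : TangentBundle (𝓡 2) M}
    (h : ξ.1 ∈ (extChartAt (𝓡 2) ζ.1).source) :
    HasFDerivAt (extChartAt (𝓡 2).tangent ζ ∘ (extChartAt (𝓡 2).tangent ξ).symm)
      (((fderiv ℝ (trans ξ.1 ζ.1) (extChartAt (𝓡 2) ξ.1 ξ.1)).comp
        (ContinuousLinearMap.fst ℝ Plane Plane)).prod
        ((fderiv ℝ (trans ξ.1 ζ.1) (extChartAt (𝓡 2) ξ.1 ξ.1)).comp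
          (ContinuousLinearMap.snd ℝ Plane Plane) +
        (((fderiv ℝ (fderiv ℝ (trans ξ.1 ζ.1)) (extChartAt (𝓡 2) ξ.1 ξ.1)).comp
          (ContinuousLinearMap.fst ℝ Plane Plane)).flip ξ.2)))
      (extChartAt (𝓡 2).tangent ξ ξ) := by
  refine HasFDerivAt.congr_of_eventuallyEq ?_ (tangent_trans_eventuallyEq h)
  rw [extChartAt_tangent_self]
  have hτ : ContDiffAt ℝ ∞ (trans ξ.1 ζ.1) (extChartAt (𝓡 2) ξ.1 ξ.1) :=
    contDiffAt_trans (mem_extChartAt_source ξ.1) h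
  have h2 : HasFDerivAt (fderiv ℝ (trans ξ.1 ζ.1)) _ (extChartAt (𝓡 2) ξ.1 ξ.1) :=
    ((hτ.fderiv_right (m := 1)
      (by rw [one_add_one_eq_two]; exact WithTop.coe_le_coe.2 le_top)).differentiableAt
        one_ne_zero).hasFDerivAt
  have hT : HasFDerivAt (trans ξ.1 ζ.1) _ (extChartAt (𝓡 2) ξ.1 ξ.1) :=
    (hτ.differentiableAt (by simp)).hasFDerivAt
  have hT' := hT.comp (f := Prod.fst)
    ((extChartAt (𝓡 2) ξ.1 ξ.1, ξ.2) : Plane × Plane) hasFDerivAt_fst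
  have h2' := h2.comp (f := Prod.fst)
    ((extChartAt (𝓡 2) ξ.1 ξ.1, ξ.2) : Plane × Plane) hasFDerivAt_fst
  exact hT'.prodMk (h2'.clm_apply hasFDerivAt_snd)

theorem tangent_trans_apply {ξ ζ : TangentBundle (𝓡 2) M}
    (h : ξ.1 ∈ (extChartAt (𝓡 2) ζ.1).source) (a b : Plane) :
    fderivWithin ℝ (extChartAt (𝓡 2).tangent ζ ∘ (extChartAt (𝓡 2).tangent ξ).symm)
      (Set.range (𝓡 2).tangent) (extChartAt (𝓡 2).tangent ξ ξ) (a, b) =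
    (fderiv ℝ (trans ξ.1 ζ.1) (extChartAt (𝓡 2) ξ.1 ξ.1) a,
      fderiv ℝ (trans ξ.1 ζ.1) (extChartAt (𝓡 2) ξ.1 ξ.1) b +
        fderiv ℝ (fderiv ℝ (trans ξ.1 ζ.1)) (extChartAt (𝓡 2) ξ.1 ξ.1) a ξ.2) := by
  rw [ModelWithCorners.range_eq_univ, fderivWithin_univ, (hasFDerivAt_tangent_trans h).fderiv]
  rfl

/-- The spray is `(x, v) ↦ (v, -D_v v)` in every chart of `TM`, not only in the preferred one at the
point, by the transformation law of the Christoffel symbols. -/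
theorem weylConnection_spray_chart (g : RiemMetric M) (α : OneForm M)
    {ξ ζ : TangentBundle (𝓡 2) M} (h : ξ.1 ∈ (extChartAt (𝓡 2) ζ.1).source) :
    fderivWithin ℝ (extChartAt (𝓡 2).tangent ζ ∘ (extChartAt (𝓡 2).tangent ξ).symm)
      (Set.range (𝓡 2).tangent) (extChartAt (𝓡 2).tangent ξ ξ)
      (geodesicSpray (weylConnection g α) ξ) =
    ((extChartAt (𝓡 2).tangent ζ ξ).2,
      -weylLocal (metricLocal g ζ.1) (formLocal α ζ.1) (extChartAt (𝓡 2).tangent ζ ξ).1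
        (extChartAt (𝓡 2).tangent ζ ξ).2) := by
  have hx := mem_extChartAt_source (I := 𝓡 2) ξ.1
  have hτ : ContDiffAt ℝ 2 (trans ξ.1 ζ.1) (extChartAt (𝓡 2) ξ.1 ξ.1) :=
    (contDiffAt_trans hx h).of_le (WithTop.coe_le_coe.2 le_top)
  rw [geodesicSpray_weylConnection]
  refine (tangent_trans_apply h _ _).trans ?_
  have hk : DifferentiableAt ℝ (metricLocal g ζ.1)
      (trans ξ.1 ζ.1 (extChartAt (𝓡 2) ξ.1 ξ.1)) := by
    rw [trans_apply hx]
    exact (contDiffAt_metricLocal g ((extChartAt (𝓡 2) ζ.1).map_source h)).differentiableAt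
      (by simp)
  have hkp : ∀ v, v ≠ 0 →
      0 < metricLocal g ζ.1 (trans ξ.1 ζ.1 (extChartAt (𝓡 2) ξ.1 ξ.1)) v v := by
    rw [trans_apply hx]
    exact metricLocal_pos g ((extChartAt (𝓡 2) ζ.1).map_source h)
  have key := weylLocal_pullback hτ hk ((contDiffAt_metricLocal g
    (mem_extChartAt_target ξ.1)).differentiableAt (by simp)) (eventually_metricLocal_trans g hx h)
    (formLocal_trans α hx h) (surjective_fderiv_trans hx h)
    (metricLocal_pos g (mem_extChartAt_target ξ.1)) hkp (metricLocal_symm g ζ.1 _) ξ.2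
  rw [map_neg, key, trans_apply hx, ← tangentCoordChange_eq, extChartAt_tangent]
  refine Prod.ext rfl ?_
  simp

set_option maxSynthPendingDepth 3 in
theorem contMDiffAt_weylConnection_spray (g : RiemMetric M) (α : OneForm M)
    (ζ : TangentBundle (𝓡 2) M) :
    ContMDiffAt (𝓡 2).tangent (𝓡 2).tangent.tangent 1
      (fun ξ => (⟨ξ, geodesicSpray (weylConnection g α) ξ⟩ :
        TangentBundle (𝓡 2).tangent (TangentBundle (𝓡 2) M))) ζ := by
  rw [Bundle.contMDiffAt_section]
  have h1 : ContDiffAt ℝ 1 (fun q : Plane × Plane => (q.2,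
      -weylLocal (metricLocal g ζ.1) (formLocal α ζ.1) q.1 q.2))
      (extChartAt (𝓡 2).tangent ζ ζ) := by
    rw [extChartAt_tangent_self]
    exact contDiffAt_snd.prodMk (contDiffAt_weylLocal
      (contDiffAt_metricLocal g (mem_extChartAt_target ζ.1))
      (contDiffAt_formLocal α (mem_extChartAt_target ζ.1))
      (metricLocal_pos g (mem_extChartAt_target ζ.1))).neg
  have h2 := h1.contMDiffAt.comp ζ (contMDiffAt_extChartAt (I := (𝓡 2).tangent) (n := 1))
  refine h2.congr_of_eventuallyEq ?_
  filter_upwards [extChartAt_source_mem_nhds (I := (𝓡 2).tangent) ζ] with ξ hξ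
  have hξ' : ξ.1 ∈ (extChartAt (𝓡 2) ζ.1).source := by
    rw [extChartAt_source] at hξ ⊢
    exact (TangentBundle.mem_chart_source_iff _ _).1 hξ
  exact weylConnection_spray_chart g α hξ'

/-- Weyl geodesics exist in every direction, the spray being of class `C¹`. -/
theorem exists_geodesic (g : RiemMetric M) (α : OneForm M) (ζ : TangentBundle (𝓡 2) M) :
    ∃ δ : ℝ → TangentBundle (𝓡 2) M, δ 0 = ζ ∧
      IsMIntegralCurveAt δ (geodesicSpray (weylConnection g α)) 0 := by
  have : IsManifold (𝓡 2).tangent ∞ (TangentBundle (𝓡 2) M) := inferInstance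
  have : IsManifold (𝓡 2).tangent 1 (TangentBundle (𝓡 2) M) := .of_le (n := ∞) (by simp)
  exact exists_isMIntegralCurveAt_of_contMDiffAt_boundaryless 0
    (contMDiffAt_weylConnection_spray g α ζ)

/-! ### Accelerations of thermostat orbits and geodesics -/

omit [IsManifold (𝓡 2) ∞ M] in
/-- The preferred chart of `TM` at `ξ` depends on the base point of `ξ` only. -/
theorem extChartAt_tangent_congr [IsManifold (𝓡 2) 1 M] {ξ ζ : TangentBundle (𝓡 2) M}
    (h : ξ.1 = ζ.1) :
    extChartAt (𝓡 2).tangent ξ = extChartAt (𝓡 2).tangent ζ := by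
  obtain ⟨x, v⟩ := ξ
  obtain ⟨y, w⟩ := ζ
  obtain rfl : x = y := h
  rfl

/-- Integral curves of a second-order vector field on `TM`, seen in a chart of `TM` whose base point
is that of the curve at `t₀`. -/
theorem secondOrder_in_chart {S : ∀ ξ : TangentBundle (𝓡 2) M, TangentSpace (𝓡 2).tangent ξ}
    (hS : ∀ ξ, (show Plane × Plane from S ξ).1 = ξ.2) {δ : ℝ → TangentBundle (𝓡 2) M} {t₀ : ℝ}
    (h : IsMIntegralCurveAt δ S t₀) {ζ : TangentBundle (𝓡 2) M} (hζ : (δ t₀).1 = ζ.1) :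
    (∀ᶠ t in 𝓝 t₀, HasDerivAt (fun s => (extChartAt (𝓡 2).tangent ζ (δ s)).1)
      (extChartAt (𝓡 2).tangent ζ (δ t)).2 t) ∧
    HasDerivAt (fun s => (extChartAt (𝓡 2).tangent ζ (δ s)).2)
      (show Plane × Plane from S (δ t₀)).2 t₀ := by
  rw [← extChartAt_tangent_congr hζ]
  have : IsManifold (𝓡 2).tangent ∞ (TangentBundle (𝓡 2) M) := inferInstance
  have : IsManifold (𝓡 2).tangent 1 (TangentBundle (𝓡 2) M) := .of_le (n := ∞) (by simp)
  have h1 := h.eventually_hasDerivAt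
  have hsrc : ∀ᶠ t in 𝓝 t₀, (δ t).1 ∈ (extChartAt (𝓡 2) (δ t₀).1).source := by
    filter_upwards [h.continuousAt.preimage_mem_nhds
      (extChartAt_source_mem_nhds (I := (𝓡 2).tangent) _)] with t ht
    rw [Set.mem_preimage, extChartAt_source] at ht
    rw [extChartAt_source]
    exact (TangentBundle.mem_chart_source_iff _ _).1 ht
  refine ⟨?_, ?_⟩
  · filter_upwards [h1, hsrc] with t ht hs
    have h2 := (hasFDerivAt_fst (𝕜 := ℝ) (E := Plane) (F := Plane)
      (p := extChartAt (𝓡 2).tangent (δ t₀) (δ t))).comp_hasDerivAt t ht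
    refine h2.congr_deriv ?_
    have h3 := congrArg Prod.fst (tangent_trans_apply hs (show Plane × Plane from S (δ t)).1
      (show Plane × Plane from S (δ t)).2)
    refine h3.trans ?_
    rw [hS, ← tangentCoordChange_eq]
    rfl
  · have h2 := (hasFDerivAt_snd (𝕜 := ℝ) (E := Plane) (F := Plane)
      (p := extChartAt (𝓡 2).tangent (δ t₀) (δ t₀))).comp_hasDerivAt t₀ h1.self_of_nhds
    refine h2.congr_deriv ?_
    have : tangentCoordChange (𝓡 2).tangent (δ t₀) (δ t₀) (δ t₀) (S (δ t₀)) = S (δ t₀) :=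
      tangentCoordChange_self (mem_extChartAt_source _)
    exact congrArg Prod.snd this

theorem radialExt_unit {g : RiemMetric M} (f : UnitTangent g → ℝ) (ξ : UnitTangent g) :
    radialExt f ξ.1 = f ξ := by
  have h1 := ξ.2
  have h0 : ξ.1.2 ≠ 0 := by
    intro h
    rw [h] at h1
    simp at h1
  rw [radialExt, dif_neg h0]
  congr 1
  apply Subtype.ext
  change (⟨ξ.1.1, (√(g.inner ξ.1.1 ξ.1.2 ξ.1.2))⁻¹ • ξ.1.2⟩ : TangentBundle (𝓡 2) M) = ξ.1
  rw [h1]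
  simp

/-- Comparison of two curves in a vector space one of which reparametrises the other. -/
theorem reparam_second_deriv {E : Type*} [NormedAddCommGroup E] [NormedSpace ℝ E]
    {x w x' w' : ℝ → E} {φ : ℝ → ℝ} {t₀ : ℝ} {A B : E}
    (hx : ∀ᶠ s in 𝓝 (φ t₀), HasDerivAt x (w s) s) (hw : HasDerivAt w A (φ t₀))
    (hx' : ∀ᶠ t in 𝓝 t₀, HasDerivAt x' (w' t) t) (hw' : HasDerivAt w' B t₀)
    (hφ : ContDiffAt ℝ 2 φ t₀) (h : ∀ᶠ t in 𝓝 t₀, x' t = x (φ t)) :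
    w' t₀ = deriv φ t₀ • w (φ t₀) ∧
      B = deriv (deriv φ) t₀ • w (φ t₀) + deriv φ t₀ ^ 2 • A := by
  have hφ1 : ∀ᶠ t in 𝓝 t₀, HasDerivAt φ (deriv φ t) t := by
    filter_upwards [hφ.eventually (by simp)] with t ht
    exact (ht.differentiableAt two_ne_zero).hasDerivAt
  have hφ2 : HasDerivAt (deriv φ) (deriv (deriv φ) t₀) t₀ := by
    have h3 : ContDiffAt ℝ 1 (deriv φ) t₀ := by
      have := (hφ.fderiv_right (m := 1) (by norm_num)).clm_apply
        (contDiffAt_const (c := (1 : ℝ)))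
      exact this
    exact (h3.differentiableAt one_ne_zero).hasDerivAt
  have key : ∀ᶠ t in 𝓝 t₀, w' t = deriv φ t • w (φ t) := by
    have hc : Filter.Tendsto φ (𝓝 t₀) (𝓝 (φ t₀)) := hφ.continuousAt
    filter_upwards [hx', hc.eventually hx, hφ1, h.eventually_nhds] with t h1 h2 h3 h4
    exact h1.unique ((h2.scomp t h3).congr_of_eventuallyEq h4)
  refine ⟨key.self_of_nhds, ?_⟩
  have h5 := hφ2.smul (hw.scomp t₀ hφ1.self_of_nhds)
  rw [hw'.unique (h5.congr_of_eventuallyEq key), smul_smul, sq, add_comm]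
  rfl

theorem thermostatField_fst (g : RiemMetric M) (l : UnitTangent g → ℝ)
    (ξ : TangentBundle (𝓡 2) M) :
    (show Plane × Plane from thermostatField g l ξ).1 = ξ.2 := by
  have : (show Plane × Plane from thermostatField g l ξ).1 =
    (show Plane from ξ.2) + radialExt l ξ • (0 : Plane) := rfl
  rw [this, smul_zero, add_zero]

theorem thermostatField_snd (g : RiemMetric M) (l : UnitTangent g → ℝ)
    (ξ : TangentBundle (𝓡 2) M) :
    (show Plane × Plane from thermostatField g l ξ).2 =
      -christoffelLocal (metricLocal g ξ.1) (extChartAt (𝓡 2) ξ.1 ξ.1) ξ.2 ξ.2 +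
        radialExt l ξ • (show Plane from rot g ξ.1 ξ.2) := by
  rw [thermostatField, geodesicField, geodesicSpray_leviCivita]
  rfl

/-- In every direction `v` there is a thermostat orbit tangent to `±v` with the unparametrised
acceleration of the geodesic of the Weyl connection in direction `v`. -/
theorem exists_acceleration_eq {g gh : RiemMetric M} {α : OneForm M} {l : UnitTangent g → ℝ}
    (hgeo : SameUnparametrisedGeodesics g l (weylConnection gh α)) (x : M)
    (v : TangentSpace (𝓡 2) x) (hv : v ≠ 0) :
    ∃ (w : TangentSpace (𝓡 2) x) (hw : g.inner x w w = 1) (c d : ℝ), w = c • v ∧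
      -christoffelLocal (metricLocal g x) (extChartAt (𝓡 2) x x) w w +
        l ⟨⟨x, w⟩, hw⟩ • (show Plane from rot g x w) =
      d • (show Plane from v) -
        c ^ 2 • weylLocal (metricLocal gh x) (formLocal α x) (extChartAt (𝓡 2) x x) v := by
  set ζ : TangentBundle (𝓡 2) M := ⟨x, v⟩ with hζ
  obtain ⟨γ, hγ0, hγ⟩ := exists_geodesic gh α ζ
  obtain ⟨ε, hε, hγε⟩ := isMIntegralCurveAt_iff'.1 hγ
  have hs2 : ∀ ξ, (show Plane × Plane from geodesicSpray (weylConnection gh α) ξ).1 = ξ.2 :=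
    fun ξ => rfl
  have hγζ := secondOrder_in_chart hs2 hγ (ζ := ζ) (by rw [hγ0])
  have hnc : ∃ t ∈ Metric.ball (0 : ℝ) ε, ∃ t' ∈ Metric.ball (0 : ℝ) ε,
      (γ t).proj ≠ (γ t').proj := by
    by_contra! hcon
    have h1 : (fun s => (extChartAt (𝓡 2).tangent ζ (γ s)).1) =ᶠ[𝓝 0]
        fun _ => extChartAt (𝓡 2) x (γ 0).proj := by
      filter_upwards [Metric.ball_mem_nhds (0 : ℝ) hε] with s hs
      exact congrArg (extChartAt (𝓡 2) x) (hcon s hs 0 (Metric.mem_ball_self hε))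
    have h2 := hγζ.1.self_of_nhds.unique ((hasDerivAt_const (0 : ℝ) _).congr_of_eventuallyEq h1)
    rw [hγ0, extChartAt_tangent_self] at h2
    exact hv h2
  obtain ⟨δ, s', hs', hδ, φ, hφ, -, hφs, hφc⟩ := hgeo.2 (fun t => (γ t).proj) (Metric.ball 0 ε)
    ⟨Metric.isOpen_ball, (convex_ball 0 ε).ordConnected, ⟨0, Metric.mem_ball_self hε⟩⟩
    ⟨γ, hγε, fun t _ => rfl⟩ hnc
  obtain ⟨t₀, ht₀, hφ0⟩ : (0 : ℝ) ∈ φ '' s' := hφs ▸ Metric.mem_ball_self hε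
  have hst : s' ∈ 𝓝 t₀ := hs'.1.mem_nhds ht₀
  have hδ' : IsMIntegralCurveAt (fun t => (δ t).1) (thermostatField g l) t₀ :=
    IsMIntegralCurveOn.isMIntegralCurveAt hδ hst
  have hbase : (δ t₀).1.proj = x := by
    refine (hφc t₀ ht₀).trans ?_
    change (γ (φ t₀)).proj = x
    rw [hφ0, hγ0]
  have hδζ := secondOrder_in_chart (thermostatField_fst g l) hδ' (ζ := ζ) hbase
  have hmain := reparam_second_deriv (φ := φ) (t₀ := t₀) (by rw [hφ0]; exact hγζ.1)
    (by rw [hφ0]; exact hγζ.2) hδζ.1 hδζ.2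
    ((hφ.contDiffAt hst).of_le (WithTop.coe_le_coe.2 le_top)) (by
      filter_upwards [hst] with t ht
      exact congrArg (extChartAt (𝓡 2) x) (hφc t ht))
  rw [hφ0, hγ0, extChartAt_tangent_self] at hmain
  obtain ⟨h1, h2⟩ := hmain
  rw [thermostatField_snd, geodesicSpray_weylConnection, radialExt_unit] at h2
  rw [← extChartAt_tangent_congr hbase, extChartAt_tangent_self] at h1
  obtain ⟨⟨⟨x', w⟩, hw⟩, hw'⟩ : ∃ η : UnitTangent g, η = δ t₀ := ⟨_, rfl⟩
  rw [← hw'] at h1 h2 hbase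
  obtain rfl : x' = x := hbase
  refine ⟨w, hw, deriv φ t₀, deriv (deriv φ) t₀, h1, h2.trans ?_⟩
  rw [smul_neg, ← sub_eq_add_neg]

/-! ### Inner products on the oriented plane -/

section PlaneForms

/-- The standard basis of `ℝ²`. -/
def stdVec (i : Fin 2) : Plane := EuclideanSpace.single i 1

theorem plane_eq (v : Plane) : v = v 0 • stdVec 0 + v 1 • stdVec 1 := by
  ext i
  fin_cases i <;> simp [stdVec]

/-- The determinant of the Gram matrix of a symmetric bilinear form on `ℝ²`. -/
def detForm (B : Plane →L[ℝ] Plane →L[ℝ] ℝ) : ℝ :=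
  B (stdVec 0) (stdVec 0) * B (stdVec 1) (stdVec 1) - B (stdVec 0) (stdVec 1) ^ 2

/-- The rotation by `π/2` of the inner product `B` and the standard orientation of `ℝ²`. -/
def rotForm (B : Plane →L[ℝ] Plane →L[ℝ] ℝ) : Plane →ₗ[ℝ] Plane where
  toFun v := (√(detForm B))⁻¹ •
    (-(B (stdVec 0) (stdVec 1) * v 0 + B (stdVec 1) (stdVec 1) * v 1) • stdVec 0 +
      (B (stdVec 0) (stdVec 0) * v 0 + B (stdVec 0) (stdVec 1) * v 1) • stdVec 1)
  map_add' v w := by simp only [PiLp.add_apply]; module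
  map_smul' c v := by simp only [PiLp.smul_apply, smul_eq_mul, RingHom.id_apply]; module

theorem rotForm_zero (B : Plane →L[ℝ] Plane →L[ℝ] ℝ) (v : Plane) :
    rotForm B v 0 =
      -(√(detForm B))⁻¹ * (B (stdVec 0) (stdVec 1) * v 0 + B (stdVec 1) (stdVec 1) * v 1) := by
  simp [rotForm, stdVec]
  ring

theorem rotForm_one (B : Plane →L[ℝ] Plane →L[ℝ] ℝ) (v : Plane) :
    rotForm B v 1 =
      (√(detForm B))⁻¹ * (B (stdVec 0) (stdVec 0) * v 0 + B (stdVec 0) (stdVec 1) * v 1) := by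
  simp [rotForm, stdVec]

variable {B : Plane →L[ℝ] Plane →L[ℝ] ℝ}

theorem form_apply (hB : ∀ v w, B v w = B w v) (v w : Plane) :
    B v w = v 0 * w 0 * B (stdVec 0) (stdVec 0) + (v 0 * w 1 + v 1 * w 0) *
      B (stdVec 0) (stdVec 1) + v 1 * w 1 * B (stdVec 1) (stdVec 1) := by
  conv_lhs => rw [plane_eq v, plane_eq w]
  simp only [map_add, map_smul, add_apply, smul_apply, smul_eq_mul, hB (stdVec 1) (stdVec 0)]
  ring

/-- The determinant of a pair of vectors of `ℝ²`. -/
def wedge (v w : Plane) : ℝ := v 0 * w 1 - v 1 * w 0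

theorem form_gram (hB : ∀ v w, B v w = B w v) (v w : Plane) :
    B v v * B w w - B v w ^ 2 = wedge v w ^ 2 * detForm B := by
  rw [form_apply hB v v, form_apply hB w w, form_apply hB v w, detForm, wedge]
  ring

theorem detForm_pos (hB : ∀ v w, B v w = B w v) (hp : ∀ v, v ≠ 0 → 0 < B v v) :
    0 < detForm B := by
  have h0 : (stdVec 0) ≠ 0 := fun h => by simpa [stdVec] using congrArg (fun v : Plane => v 0) h
  have h00 := hp _ h0
  set v : Plane := B (stdVec 0) (stdVec 1) • stdVec 0 - B (stdVec 0) (stdVec 0) • stdVec 1 with hv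
  have hv0 : v ≠ 0 := fun h => by
    have := congrArg (fun v : Plane => v 1) h
    simp [hv, stdVec] at this
    exact h00.ne' this
  have h1 := hp v hv0
  have h2 : B v v = B (stdVec 0) (stdVec 0) * detForm B := by
    simp only [hv, map_sub, map_smul, sub_apply, smul_apply, smul_eq_mul, hB (stdVec 1) (stdVec 0),
      detForm]
    ring
  rw [h2] at h1
  exact pos_of_mul_pos_right h1 h00.le

theorem form_rotForm (hB : ∀ v w, B v w = B w v) (hp : ∀ v, v ≠ 0 → 0 < B v v) (v w : Plane) :
    B v (rotForm B w) = √(detForm B) * wedge w v := by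
  have hD := detForm_pos hB hp
  have hs := Real.sq_sqrt hD.le
  have hs0 := (Real.sqrt_pos.2 hD).ne'
  rw [form_apply hB, rotForm_zero, rotForm_one, wedge]
  field_simp
  rw [hs, detForm]
  ring

theorem wedge_rotForm (hB : ∀ v w, B v w = B w v) (hp : ∀ v, v ≠ 0 → 0 < B v v) (v w : Plane) :
    √(detForm B) * wedge v (rotForm B w) = B v w := by
  have hs0 := (Real.sqrt_pos.2 (detForm_pos hB hp)).ne'
  rw [wedge, form_apply hB, rotForm_zero, rotForm_one]
  field_simp
  ring

theorem rotForm_rotForm (hB : ∀ v w, B v w = B w v) (hp : ∀ v, v ≠ 0 → 0 < B v v) (v : Plane) :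
    rotForm B (rotForm B v) = -v := by
  have hD := detForm_pos hB hp
  have hs := Real.sq_sqrt hD.le
  have hs0 := (Real.sqrt_pos.2 hD).ne'
  ext i
  fin_cases i
  · simp only [Fin.zero_eta, PiLp.neg_apply]
    rw [rotForm_zero, rotForm_zero, rotForm_one]
    field_simp
    rw [hs, detForm]
    ring
  · simp only [Fin.mk_one, PiLp.neg_apply]
    rw [rotForm_one, rotForm_zero, rotForm_one]
    field_simp
    rw [hs, detForm]
    ring

theorem form_rotForm_rotForm (hB : ∀ v w, B v w = B w v) (hp : ∀ v, v ≠ 0 → 0 < B v v)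
    (v w : Plane) : B (rotForm B v) (rotForm B w) = B v w := by
  rw [form_rotForm hB hp, wedge_rotForm hB hp, hB]

theorem form_rotForm_self (hB : ∀ v w, B v w = B w v) (hp : ∀ v, v ≠ 0 → 0 < B v v)
    (v : Plane) : B v (rotForm B v) = 0 := by
  rw [form_rotForm hB hp, wedge]; ring

theorem detForm_pullback (hB : ∀ v w, B v w = B w v) {B' : Plane →L[ℝ] Plane →L[ℝ] ℝ}
    {T : Plane →L[ℝ] Plane} (h : ∀ v w, B' v w = B (T v) (T w)) :
    detForm B' = wedge (T (stdVec 0)) (T (stdVec 1)) ^ 2 * detForm B := by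
  rw [← form_gram hB, detForm, h, h, h]

theorem det_eq_wedge (T : Plane →L[ℝ] Plane) : T.det = wedge (T (stdVec 0)) (T (stdVec 1)) := by
  rw [ContinuousLinearMap.det, ← LinearMap.det_toMatrix (EuclideanSpace.basisFun (Fin 2) ℝ).toBasis,
    Matrix.det_fin_two]
  simp [LinearMap.toMatrix_apply, wedge, stdVec]
  ring

theorem wedge_map (T : Plane →L[ℝ] Plane) (v w : Plane) :
    wedge (T v) (T w) = wedge (T (stdVec 0)) (T (stdVec 1)) * wedge v w := by
  conv_lhs => rw [plane_eq v, plane_eq w]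
  simp only [wedge, map_add, map_smul, PiLp.add_apply, PiLp.smul_apply, smul_eq_mul]
  ring

/-- Orientation-preserving isometries commute with the rotations. -/
theorem rotForm_pullback (hB : ∀ v w, B v w = B w v) (hp : ∀ v, v ≠ 0 → 0 < B v v)
    {B' : Plane →L[ℝ] Plane →L[ℝ] ℝ} {T : Plane →L[ℝ] Plane}
    (h : ∀ v w, B' v w = B (T v) (T w)) (hp' : ∀ v, v ≠ 0 → 0 < B' v v) (hT : 0 < T.det)
    (hsurj : Function.Surjective T) (v : Plane) :
    T (rotForm B' v) = rotForm B (T v) := by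
  apply injective_of_pos hp
  ext z
  obtain ⟨z, rfl⟩ := hsurj z
  have hB' : ∀ v w, B' v w = B' w v := fun v w => by rw [h, h, hB]
  rw [← h, hB', form_rotForm hB' hp', hB, form_rotForm hB hp, wedge_map, detForm_pullback hB h,
    Real.sqrt_mul (sq_nonneg _), Real.sqrt_sq (by rw [← det_eq_wedge]; exact hT.le)]
  ring

/-- The trace of `T`, computed in the orthonormal frame `v, J v` and in the standard basis. -/
theorem trace_frame (hB : ∀ v w, B v w = B w v) (hp : ∀ v, v ≠ 0 → 0 < B v v) {v : Plane}
    (hv : B v v = 1) (T : Plane →L[ℝ] Plane) :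
    B (T v) v + B (T (rotForm B v)) (rotForm B v) = T (stdVec 0) 0 + T (stdVec 1) 1 := by
  have h1 : wedge (T v) (rotForm B v) + wedge v (T (rotForm B v)) =
      (T (stdVec 0) 0 + T (stdVec 1) 1) * wedge v (rotForm B v) := by
    generalize rotForm B v = w
    rw [plane_eq v, plane_eq w]
    simp only [wedge, map_add, map_smul, PiLp.add_apply, PiLp.smul_apply, smul_eq_mul]
    simp [stdVec]
    ring
  have h2 := wedge_rotForm hB hp v v
  rw [form_rotForm hB hp, ← wedge_rotForm hB hp (T v), ← mul_add, h1, mul_left_comm, h2, hv,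
    mul_one]

theorem frame_expand (hB : ∀ v w, B v w = B w v) (hp : ∀ v, v ≠ 0 → 0 < B v v) {v : Plane}
    (hv : B v v = 1) (z : Plane) : z = B z v • v + B z (rotForm B v) • rotForm B v := by
  have h1 : √(detForm B) * wedge v (rotForm B v) = 1 := (wedge_rotForm hB hp v v).trans hv
  rw [form_rotForm hB hp, ← wedge_rotForm hB hp z]
  generalize √(detForm B) = s at h1 ⊢
  generalize rotForm B v = w at h1 ⊢
  have h2 : wedge v w • z = wedge z w • v + wedge v z • w := by
    ext i
    fin_cases i <;> simp [wedge] <;> ring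
  rw [mul_smul, mul_smul, ← smul_add, ← h2, smul_smul, h1, one_smul]

end PlaneForms

/-! ### The derivative of `u` in coordinates -/

section Transport

/-- The trace of `w ↦ Γ(z, w)`. -/
def christoffelTrace (h : Plane → Plane →L[ℝ] Plane →L[ℝ] ℝ) (p z : Plane) : ℝ :=
  christoffelLocal h p z (stdVec 0) 0 + christoffelLocal h p z (stdVec 1) 1

variable {h k : Plane → Plane →L[ℝ] Plane →L[ℝ] ℝ} {p : Plane}

set_option maxSynthPendingDepth 3 in
theorem fderiv_metric_apply (hh : DifferentiableAt ℝ h p) (z v w : Plane) :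
    HasDerivAt (fun s : ℝ => h (p + s • z) v w) (fderiv ℝ h p z v w) 0 := by
  have hl : HasDerivAt (fun s : ℝ => p + s • z) z 0 := by
    simpa using ((hasDerivAt_id (0 : ℝ)).smul_const z).const_add p
  have h1 : HasFDerivAt h (fderiv ℝ h p) (p + (0 : ℝ) • z) := by simpa using hh.hasFDerivAt
  have h2 := h1.comp_hasDerivAt (0 : ℝ) hl
  have h3 := (h2.clm_apply (hasDerivAt_const 0 v)).clm_apply (hasDerivAt_const 0 w)
  simpa using h3

/-- The Levi-Civita connection is compatible with the metric. -/
theorem fderiv_metric_eq (hh : DifferentiableAt ℝ h p) (hs : ∀ q v w, h q v w = h q w v)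
    (hp : ∀ v, v ≠ 0 → 0 < h p v v) (z v w : Plane) :
    fderiv ℝ h p z v w =
      h p (christoffelLocal h p z v) w + h p v (christoffelLocal h p z w) := by
  have hsym (z v w : Plane) : fderiv ℝ h p z v w = fderiv ℝ h p z w v :=
    (fderiv_metric_apply hh z v w).unique
      ((fderiv_metric_apply hh z w v).congr_of_eventuallyEq (.of_forall fun s => hs _ v w))
  rw [hs p v]
  simp only [christoffelLocal, apply_inverse_of_pos hp, koszul_apply]
  rw [hsym v z w, hsym w z v, hsym z w v]
  ring

set_option maxSynthPendingDepth 3 in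
theorem hasDerivAt_metric_line (hh : DifferentiableAt ℝ h p) (hs : ∀ q v w, h q v w = h q w v)
    (hp : ∀ v, v ≠ 0 → 0 < h p v v) (z v b : Plane) :
    HasDerivAt (fun s : ℝ => h (p + s • z) (v + s • b) (v + s • b))
      (2 * h p v (christoffelLocal h p z v + b)) 0 := by
  have hl (a b : Plane) : HasDerivAt (fun s : ℝ => a + s • b) b 0 := by
    simpa using ((hasDerivAt_id (0 : ℝ)).smul_const b).const_add a
  have h1 : HasFDerivAt h (fderiv ℝ h p) (p + (0 : ℝ) • z) := by simpa using hh.hasFDerivAt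
  have h2 := h1.comp_hasDerivAt (0 : ℝ) (hl p z)
  have h3 := (h2.clm_apply (hl v b)).clm_apply (hl v b)
  refine h3.congr_deriv ?_
  simp
  rw [fderiv_metric_eq hh hs hp, hs p b v, hs p (christoffelLocal h p z v) v]
  ring

/-- The logarithmic derivative of the volume density is the trace of the Christoffel symbols. -/
theorem hasDerivAt_detForm (hh : DifferentiableAt ℝ h p) (hs : ∀ q v w, h q v w = h q w v)
    (hp : ∀ v, v ≠ 0 → 0 < h p v v) (z : Plane) :
    HasDerivAt (fun s : ℝ => detForm (h (p + s • z)))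
      (2 * christoffelTrace h p z * detForm (h p)) 0 := by
  have h1 := ((fderiv_metric_apply hh z (stdVec 0) (stdVec 0)).mul
    (fderiv_metric_apply hh z (stdVec 1) (stdVec 1))).sub
    ((fderiv_metric_apply hh z (stdVec 0) (stdVec 1)).pow 2)
  refine h1.congr_deriv ?_
  simp only [zero_smul, add_zero, fderiv_metric_eq hh hs hp, christoffelTrace]
  generalize christoffelLocal h p z (stdVec 0) = u
  generalize christoffelLocal h p z (stdVec 1) = w
  rw [form_apply (hs p) u (stdVec 0), form_apply (hs p) u (stdVec 1),
    form_apply (hs p) w (stdVec 1), form_apply (hs p) _ u, form_apply (hs p) _ w,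
    form_apply (hs p) _ w]
  simp only [detForm]
  simp [stdVec]
  ring

/-- The function `u` in coordinates, extended to be constant along rays. -/
def uLocal (h k : Plane → Plane →L[ℝ] Plane →L[ℝ] ℝ) (q : Plane × Plane) : ℝ :=
  3 / 2 * Real.log (h q.1 q.2 q.2) - 3 / 2 * Real.log (k q.1 q.2 q.2) -
    Real.log (detForm (h q.1)) + Real.log (detForm (k q.1))

set_option maxSynthPendingDepth 3 in
theorem contDiffAt_uLocal (hh : ContDiffAt ℝ ∞ h p) (hk : ContDiffAt ℝ ∞ k p)
    (hhs : ∀ v w, h p v w = h p w v) (hks : ∀ v w, k p v w = k p w v)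
    (hhp : ∀ v, v ≠ 0 → 0 < h p v v) (hkp : ∀ v, v ≠ 0 → 0 < k p v v) {v : Plane} (hv : v ≠ 0) :
    ContDiffAt ℝ ∞ (uLocal h k) (p, v) := by
  have hh1 : ContDiffAt ℝ ∞ (fun q : Plane × Plane => h q.1) (p, v) := hh.comp (p, v) contDiffAt_fst
  have hk1 : ContDiffAt ℝ ∞ (fun q : Plane × Plane => k q.1) (p, v) := hk.comp (p, v) contDiffAt_fst
  have hv1 : ContDiffAt ℝ ∞ (fun q : Plane × Plane => q.2) (p, v) := contDiffAt_snd
  have hd (B : Plane × Plane → Plane →L[ℝ] Plane →L[ℝ] ℝ) (hB : ContDiffAt ℝ ∞ B (p, v)) :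
      ContDiffAt ℝ ∞ (fun q => detForm (B q)) (p, v) := by
    have he (i j : Fin 2) : ContDiffAt ℝ ∞ (fun q => B q (stdVec i) (stdVec j)) (p, v) :=
      (hB.clm_apply contDiffAt_const).clm_apply contDiffAt_const
    exact ((he 0 0).mul (he 1 1)).sub ((he 0 1).pow 2)
  refine (((contDiffAt_const.mul (((hh1.clm_apply hv1).clm_apply hv1).log ?_)).sub
    (contDiffAt_const.mul (((hk1.clm_apply hv1).clm_apply hv1).log ?_))).sub
    ((hd _ hh1).log ?_)).add ((hd _ hk1).log ?_)
  · exact (hhp v hv).ne'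
  · exact (hkp v hv).ne'
  · exact (detForm_pos hhs hhp).ne'
  · exact (detForm_pos hks hkp).ne'

/-- The derivative of `u` at `(p, v)` in the direction `(z, b)`; by metric compatibility only the
Christoffel symbols of the two metrics enter. -/
theorem fderiv_uLocal (hh : ContDiffAt ℝ ∞ h p) (hk : ContDiffAt ℝ ∞ k p)
    (hhs : ∀ q v w, h q v w = h q w v) (hks : ∀ q v w, k q v w = k q w v)
    (hhp : ∀ v, v ≠ 0 → 0 < h p v v) (hkp : ∀ v, v ≠ 0 → 0 < k p v v) {v : Plane} (hv : v ≠ 0)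
    (z b : Plane) :
    fderiv ℝ (uLocal h k) (p, v) (z, b) =
      3 * h p v (christoffelLocal h p z v + b) / h p v v -
      3 * k p v (christoffelLocal k p z v + b) / k p v v -
      2 * christoffelTrace h p z + 2 * christoffelTrace k p z := by
  have hd := ((contDiffAt_uLocal hh hk (hhs p) (hks p) hhp hkp hv).differentiableAt
    (by simp)).hasFDerivAt
  have hl : HasDerivAt (fun s : ℝ => ((p + s • z, v + s • b) : Plane × Plane)) (z, b) 0 := by
    have h1 (a b : Plane) : HasDerivAt (fun s : ℝ => a + s • b) b 0 := by
      simpa using ((hasDerivAt_id (0 : ℝ)).smul_const b).const_add a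
    exact (h1 p z).prodMk (h1 v b)
  have h2 := HasFDerivAt.comp_hasDerivAt (0 : ℝ) (l := uLocal h k) (by simpa using hd) hl
  have hh' : DifferentiableAt ℝ h p := hh.differentiableAt (by simp)
  have hk' : DifferentiableAt ℝ k p := hk.differentiableAt (by simp)
  have e1 := (hasDerivAt_metric_line hh' hhs hhp z v b).log (by simpa using (hhp v hv).ne')
  have e2 := (hasDerivAt_metric_line hk' hks hkp z v b).log (by simpa using (hkp v hv).ne')
  have e3 := (hasDerivAt_detForm hh' hhs hhp z).log
    (by simpa using (detForm_pos (hhs p) hhp).ne')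
  have e4 := (hasDerivAt_detForm hk' hks hkp z).log
    (by simpa using (detForm_pos (hks p) hkp).ne')
  have e := (((e1.const_mul (3 / 2)).sub (e2.const_mul (3 / 2))).sub e3).add e4
  rw [h2.unique e]
  have d1 := (detForm_pos (hhs p) hhp).ne'
  have d2 := (detForm_pos (hks p) hkp).ne'
  simp only [zero_smul, add_zero]
  field_simp

end Transport

/-! ### The difference of two sprays -/

section Transport

variable {h k : Plane → Plane →L[ℝ] Plane →L[ℝ] ℝ} {a : Plane → Plane →L[ℝ] ℝ} {p : Plane}

set_option maxSynthPendingDepth 3 in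
theorem raise_eq_christoffelLocal (h : Plane → Plane →L[ℝ] Plane →L[ℝ] ℝ) (p v w : Plane) :
    raise (h p).inverse (koszul (fderiv ℝ h p)) v w = christoffelLocal h p v w := rfl

set_option maxSynthPendingDepth 3 in
theorem christoffelTrace_eq (h : Plane → Plane →L[ℝ] Plane →L[ℝ] ℝ)
    {B : Plane →L[ℝ] Plane →L[ℝ] ℝ} (hB : ∀ v w, B v w = B w v)
    (hp : ∀ v, v ≠ 0 → 0 < B v v) {v : Plane} (hv : B v v = 1) :
    christoffelTrace h p v = B (christoffelLocal h p v v) v +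
      B (christoffelLocal h p v (rotForm B v)) (rotForm B v) :=
  (trace_frame hB hp hv (raise (h p).inverse (koszul (fderiv ℝ h p)) v)).symm

theorem christoffelLocal_symm (hh : DifferentiableAt ℝ h p) (hs : ∀ q v w, h q v w = h q w v)
    (v w : Plane) : christoffelLocal h p v w = christoffelLocal h p w v := by
  rw [christoffelLocal, christoffelLocal]
  congr 1
  ext z
  rw [koszul_apply, koszul_apply, (fderiv_metric_apply hh z v w).unique
    ((fderiv_metric_apply hh z w v).congr_of_eventuallyEq (.of_forall fun s => hs _ v w))]
  ring

/-- The polarisation of `Γᵏ(v, v) - D_v v`, the difference of the sprays of the Weyl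
connection of `(h, a)` and the Levi-Civita connection of `k`. -/
def sprayDiff (h k : Plane → Plane →L[ℝ] Plane →L[ℝ] ℝ) (a : Plane → Plane →L[ℝ] ℝ)
    (p v w : Plane) : Plane :=
  christoffelLocal k p v w - (christoffelLocal h p v w + h p v w • (h p).inverse (a p) -
    a p v • w - a p w • v)

theorem sprayDiff_self (v : Plane) :
    sprayDiff h k a p v v = christoffelLocal k p v v - weylLocal h a p v := by
  rw [sprayDiff, weylLocal, two_mul, add_smul]
  abel

theorem sprayDiff_symm (hh : DifferentiableAt ℝ h p) (hk : DifferentiableAt ℝ k p)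
    (hhs : ∀ q v w, h q v w = h q w v) (hks : ∀ q v w, k q v w = k q w v) (v w : Plane) :
    sprayDiff h k a p v w = sprayDiff h k a p w v := by
  rw [sprayDiff, sprayDiff, christoffelLocal_symm hh hhs, christoffelLocal_symm hk hks, hhs]
  abel

set_option maxSynthPendingDepth 3 in
theorem hasDerivAt_sprayDiff {c : ℝ → Plane} {c' : Plane} {t : ℝ} (hc : HasDerivAt c c' t) :
    HasDerivAt (fun s => sprayDiff h k a p (c s) (c s))
      (sprayDiff h k a p c' (c t) + sprayDiff h k a p (c t) c') t := by
  have h1 (h : Plane → Plane →L[ℝ] Plane →L[ℝ] ℝ) :=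
    ((raise (h p).inverse (koszul (fderiv ℝ h p))).hasFDerivAt.comp_hasDerivAt t hc).clm_apply hc
  have h2 := (((h p).hasFDerivAt.comp_hasDerivAt t hc).clm_apply hc).smul_const
    ((h p).inverse (a p))
  have h3 := ((a p).hasFDerivAt.comp_hasDerivAt t hc).smul hc
  have h4 := (h1 k).sub ((((h1 h).add h2).sub h3).sub h3)
  refine h4.congr_deriv ?_
  simp only [sprayDiff, raise_eq_christoffelLocal, Function.comp_apply]
  module

/-- The pointwise transport equation: if `l = k(Γᵏ(v, v) - D_v v, J v)`, then `V l = F u + a`. -/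
theorem hasDerivAt_curvature (hh : ContDiffAt ℝ ∞ h p) (hk : ContDiffAt ℝ ∞ k p)
    (hhs : ∀ q v w, h q v w = h q w v) (hks : ∀ q v w, k q v w = k q w v)
    (hhp : ∀ v, v ≠ 0 → 0 < h p v v) (hkp : ∀ v, v ≠ 0 → 0 < k p v v) {v : Plane}
    (hv : k p v v = 1) :
    HasDerivAt (fun t : ℝ =>
      k p (sprayDiff h k a p (Real.cos t • v + Real.sin t • rotForm (k p) v)
        (Real.cos t • v + Real.sin t • rotForm (k p) v))
        (rotForm (k p) (Real.cos t • v + Real.sin t • rotForm (k p) v)))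
      (fderiv ℝ (uLocal h k) (p, v) (v, -christoffelLocal k p v v +
        k p (sprayDiff h k a p v v) (rotForm (k p) v) • rotForm (k p) v) + a p v) 0 := by
  have hh' : DifferentiableAt ℝ h p := hh.differentiableAt (by simp)
  have hk' : DifferentiableAt ℝ k p := hk.differentiableAt (by simp)
  have hv0 : v ≠ 0 := fun h0 => by simp [h0] at hv
  have hJJ : rotForm (k p) (rotForm (k p) v) = -v := rotForm_rotForm (hks p) hkp v
  have ht1 := christoffelTrace_eq (p := p) h (hks p) hkp hv
  have ht2 := christoffelTrace_eq (p := p) k (hks p) hkp hv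
  have hJv : k p v (rotForm (k p) v) = 0 := form_rotForm_self (hks p) hkp v
  have hexp := frame_expand (hks p) hkp hv (sprayDiff h k a p v v)
  have hexp2 := frame_expand (hks p) hkp hv ((h p).inverse (a p))
  have hfd := fderiv_uLocal hh hk hhs hks hhp hkp hv0 v (-christoffelLocal k p v v +
        k p (sprayDiff h k a p v v) (rotForm (k p) v) • rotForm (k p) v)
  have hjj : k p (rotForm (k p) v) (rotForm (k p) v) = 1 :=
    (form_rotForm_rotForm (hks p) hkp v v).trans hv
  have hJc (t : ℝ) : rotForm (k p) (Real.cos t • v + Real.sin t • rotForm (k p) v) =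
      Real.cos t • rotForm (k p) v + Real.sin t • -v := by
    rw [map_add, map_smul, map_smul, hJJ]
  simp only [hJc]
  generalize rotForm (k p) v = j at *
  have hcos : HasDerivAt (fun t : ℝ => Real.cos t • v + Real.sin t • j) j 0 := by
    exact (((Real.hasDerivAt_cos 0).smul_const v).add
      ((Real.hasDerivAt_sin 0).smul_const j)).congr_deriv (by simp)
  have hcos2 : HasDerivAt (fun t : ℝ => Real.cos t • j + Real.sin t • -v) (-v) 0 := by
    exact (((Real.hasDerivAt_cos 0).smul_const j).add
      ((Real.hasDerivAt_sin 0).smul_const (-v))).congr_deriv (by simp)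
  have hN := hasDerivAt_sprayDiff (h := h) (k := k) (a := a) (p := p) hcos
  have hmain := ((k p).hasFDerivAt.comp_hasDerivAt 0 hN).clm_apply hcos2
  refine hmain.congr_deriv ?_
  simp only [Real.cos_zero, Real.sin_zero, one_smul, zero_smul, add_zero, Function.comp_apply]
  rw [sprayDiff_symm hh' hk' hhs hks j v]
  have hS (w : Plane) : h p w ((h p).inverse (a p)) = a p w := by
    rw [hhs, apply_inverse_of_pos hhp]
  -- the component of `D_v v` along `v`
  have hu : h p v (christoffelLocal h p v v + (-christoffelLocal k p v v +
      k p (sprayDiff h k a p v v) j • j)) =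
      h p v v * (a p v - k p (sprayDiff h k a p v v) v) := by
    have e : christoffelLocal h p v v + (-christoffelLocal k p v v +
      k p (sprayDiff h k a p v v) j • j) = (2 * a p v - k p (sprayDiff h k a p v v) v) • v -
        h p v v • (h p).inverse (a p) := by
      have e1 : k p (sprayDiff h k a p v v) j • j =
        sprayDiff h k a p v v - k p (sprayDiff h k a p v v) v • v := by
        rw [eq_sub_iff_add_eq, add_comm]; exact hexp.symm
      rw [e1]
      generalize k p (sprayDiff h k a p v v) v = m
      rw [sprayDiff]
      module
    rw [e, map_sub, map_smul, map_smul, hS]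
    simp only [smul_eq_mul]
    ring
  have hkz : k p v (christoffelLocal k p v v + (-christoffelLocal k p v v +
      k p (sprayDiff h k a p v v) j • j)) = 0 := by
    rw [add_neg_cancel_left, map_smul, hJv, smul_zero]
  rw [hfd, hu, hkz, ht1, ht2]
  have hSv : h p v v * k p ((h p).inverse (a p)) v + h p v j * k p ((h p).inverse (a p)) j =
      a p v := by
    conv_rhs => rw [← hS v, hexp2]
    simp only [map_add, map_smul, smul_eq_mul]
    ring
  have hvp := (hhp v hv0).ne'
  rw [mul_div_assoc, mul_comm (h p v v), mul_div_assoc, div_self hvp]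
  simp only [sprayDiff, map_add, map_sub, map_smul, map_neg, add_apply, sub_apply, smul_apply,
    smul_eq_mul, hv, hjj, hJv]
  linear_combination -2 * hSv

end Transport

/-! ### Cubic functions on the circle -/

/-- Solutions of `f'' = -9 f` change sign under the half turn. -/
theorem antiperiodic_of_deriv_deriv {f f' : ℝ → ℝ} (h1 : ∀ t, HasDerivAt f (f' t) t)
    (h2 : ∀ t, HasDerivAt f' (-(9 * f t)) t) (t : ℝ) : f (t + Real.pi) = -f t := by
  have hc (t : ℝ) : HasDerivAt (fun t => Real.cos (3 * t)) (-(3 * Real.sin (3 * t))) t := by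
    have := (Real.hasDerivAt_cos (3 * t)).comp t ((hasDerivAt_id t).const_mul 3)
    exact this.congr_deriv (by ring)
  have hs (t : ℝ) : HasDerivAt (fun t => Real.sin (3 * t)) (3 * Real.cos (3 * t)) t := by
    have := (Real.hasDerivAt_sin (3 * t)).comp t ((hasDerivAt_id t).const_mul 3)
    exact this.congr_deriv (by ring)
  -- the two first integrals `3 f cos 3t - f' sin 3t` and `3 f sin 3t + f' cos 3t`
  have hA (t : ℝ) : HasDerivAt (fun t => 3 * f t * Real.cos (3 * t) - f' t * Real.sin (3 * t))
      0 t :=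
    ((((h1 t).const_mul 3).mul (hc t)).sub ((h2 t).mul (hs t))).congr_deriv (by ring)
  have hB (t : ℝ) : HasDerivAt (fun t => 3 * f t * Real.sin (3 * t) + f' t * Real.cos (3 * t))
      0 t :=
    ((((h1 t).const_mul 3).mul (hs t)).add ((h2 t).mul (hc t))).congr_deriv (by ring)
  have eA := is_const_of_deriv_eq_zero (fun t => (hA t).differentiableAt) (fun t => (hA t).deriv)
    (t + Real.pi) t
  have eB := is_const_of_deriv_eq_zero (fun t => (hB t).differentiableAt) (fun t => (hB t).deriv)
    (t + Real.pi) t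
  have e3 : 3 * (t + Real.pi) = 3 * t + Real.pi + 2 * Real.pi := by ring
  simp only [e3, Real.cos_add_two_pi, Real.sin_add_two_pi, Real.cos_add_pi, Real.sin_add_pi]
    at eA eB
  have hsq := Real.sin_sq_add_cos_sq (3 * t)
  linear_combination (-Real.cos (3 * t) / 3) * eA - Real.sin (3 * t) / 3 * eB -
    (f (t + Real.pi) + f t) * hsq

/-! ### Functions on the unit tangent bundle in charts -/

theorem tangentCoordChange_left_inv {x z : M} (hz : z ∈ (extChartAt (𝓡 2) x).source) (v : Plane) :
    tangentCoordChange (𝓡 2) x z z (tangentCoordChange (𝓡 2) z x z v) = v := by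
  have hz' := mem_extChartAt_source (I := 𝓡 2) z
  rw [tangentCoordChange_comp ⟨⟨hz', hz⟩, hz'⟩, tangentCoordChange_self hz']

theorem inner_eq_metricLocal (g : RiemMetric M) (x : M) {z : M}
    (hz : z ∈ (extChartAt (𝓡 2) x).source) (v w : TangentSpace (𝓡 2) z) :
    g.inner z v w = metricLocal g x (extChartAt (𝓡 2) x z) (tangentCoordChange (𝓡 2) z x z v)
      (tangentCoordChange (𝓡 2) z x z w) := by
  rw [metricLocal, (extChartAt (𝓡 2) x).left_inv hz, metricCoord_apply g hz]
  have hv : tangentCoordChange (𝓡 2) x z z (tangentCoordChange (𝓡 2) z x z v) = v :=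
    tangentCoordChange_left_inv hz v
  have hw : tangentCoordChange (𝓡 2) x z z (tangentCoordChange (𝓡 2) z x z w) = w :=
    tangentCoordChange_left_inv hz w
  rw [hv, hw]

theorem form_eq_formLocal (θ : OneForm M) (x : M) {z : M}
    (hz : z ∈ (extChartAt (𝓡 2) x).source) (v : TangentSpace (𝓡 2) z) :
    θ z v = formLocal θ x (extChartAt (𝓡 2) x z) (tangentCoordChange (𝓡 2) z x z v) := by
  have hv : tangentCoordChange (𝓡 2) x z z (tangentCoordChange (𝓡 2) z x z v) = v :=
    tangentCoordChange_left_inv hz v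
  rw [formLocal_apply θ ((extChartAt (𝓡 2) x).map_source hz), (extChartAt (𝓡 2) x).left_inv hz, hv]

theorem mem_extChartAt_tangent_source {ξ ζ : TangentBundle (𝓡 2) M} :
    ζ ∈ (extChartAt (𝓡 2).tangent ξ).source ↔ ζ.1 ∈ (extChartAt (𝓡 2) ξ.1).source := by
  rw [extChartAt_source, extChartAt_source]
  exact TangentBundle.mem_chart_source_iff _ _

theorem eventually_snd_ne_zero {ξ : TangentBundle (𝓡 2) M} (hξ : ξ.2 ≠ 0) :
    ∀ᶠ ζ in 𝓝 ξ, ζ.1 ∈ (extChartAt (𝓡 2) ξ.1).source ∧ ζ.2 ≠ 0 := by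
  have h1 : ∀ᶠ ζ in 𝓝 ξ, (extChartAt (𝓡 2).tangent ξ ζ).2 ≠ 0 := by
    have hc : ContinuousAt (fun ζ => (extChartAt (𝓡 2).tangent ξ ζ).2) ξ :=
      continuous_snd.continuousAt.comp (continuousAt_extChartAt (I := (𝓡 2).tangent) ξ)
    refine hc.eventually_ne ?_
    rw [extChartAt_tangent_self]
    exact hξ
  filter_upwards [extChartAt_source_mem_nhds (I := (𝓡 2).tangent) ξ, h1] with ζ hζ h
  refine ⟨mem_extChartAt_tangent_source.1 hζ, fun h0 => h ?_⟩
  rw [extChartAt_tangent, h0]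
  exact map_zero _

/-- A function on `SM` is smooth when its radial extension is smooth in charts. -/
theorem isSmooth_of_chart {g : RiemMetric M} {f : UnitTangent g → ℝ}
    (F : TangentBundle (𝓡 2) M → Plane × Plane → ℝ)
    (hF : ∀ ξ, ξ.2 ≠ 0 → ContDiffAt ℝ ∞ (F ξ) (extChartAt (𝓡 2).tangent ξ ξ))
    (h : ∀ ξ ζ : TangentBundle (𝓡 2) M, ζ.1 ∈ (extChartAt (𝓡 2) ξ.1).source → ζ.2 ≠ 0 →
      radialExt f ζ = F ξ (extChartAt (𝓡 2).tangent ξ ζ)) : IsSmooth f := by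
  intro ξ hξ
  have h2 := (hF ξ hξ).contMDiffAt.comp ξ (contMDiffAt_extChartAt (I := (𝓡 2).tangent) (n := ∞))
  refine (h2.congr_of_eventuallyEq ?_).contMDiffWithinAt
  filter_upwards [eventually_snd_ne_zero hξ] with ζ hζ using h ξ ζ hζ.1 hζ.2

theorem unit_ne_zero {g : RiemMetric M} (η : UnitTangent g) : η.1.2 ≠ 0 := by
  intro h
  have h1 := η.2
  rw [h] at h1
  simp at h1

theorem isOpen_snd_ne_zero : IsOpen {ξ : TangentBundle (𝓡 2) M | ξ.2 ≠ 0} := by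
  rw [isOpen_iff_mem_nhds]
  intro ξ hξ
  filter_upwards [eventually_snd_ne_zero hξ] with ζ hζ using hζ.2

/-- `f` in the chart of the tangent bundle at `ξ`. -/
def inChart {g : RiemMetric M} (f : UnitTangent g → ℝ) (ξ : TangentBundle (𝓡 2) M)
    (q : Plane × Plane) : ℝ := radialExt f ((extChartAt (𝓡 2).tangent ξ).symm q)

theorem radialExt_eq_inChart {g : RiemMetric M} (f : UnitTangent g → ℝ)
    {ξ ζ : TangentBundle (𝓡 2) M} (h : ζ.1 ∈ (extChartAt (𝓡 2) ξ.1).source) :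
    radialExt f ζ = inChart f ξ (extChartAt (𝓡 2).tangent ξ ζ) := by
  rw [inChart, (extChartAt (𝓡 2).tangent ξ).left_inv (mem_extChartAt_tangent_source.2 h)]

theorem contDiffAt_inChart {g : RiemMetric M} {f : UnitTangent g → ℝ} (hf : IsSmooth f)
    {ξ ζ : TangentBundle (𝓡 2) M} (h : ζ.1 ∈ (extChartAt (𝓡 2) ξ.1).source) (hζ : ζ.2 ≠ 0) :
    ContDiffAt ℝ ∞ (inChart f ξ) (extChartAt (𝓡 2).tangent ξ ζ) := by
  have h1 := (hf ζ hζ).contMDiffAt (isOpen_snd_ne_zero.mem_nhds hζ)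
  have hs := mem_extChartAt_tangent_source.2 h
  have h2 : ContMDiffAt 𝓘(ℝ, Plane × Plane) (𝓡 2).tangent ∞ (extChartAt (𝓡 2).tangent ξ).symm
      (extChartAt (𝓡 2).tangent ξ ζ) :=
    (contMDiffOn_extChartAt_symm ξ).contMDiffAt
      ((isOpen_extChartAt_target ξ).mem_nhds ((extChartAt (𝓡 2).tangent ξ).map_source hs))
  rw [← (extChartAt (𝓡 2).tangent ξ).left_inv hs] at h1
  exact (h1.comp _ h2).contDiffAt

/-- The derivative along a vector field, computed in an arbitrary chart of the tangent bundle. -/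
theorem along_eq {g : RiemMetric M} {f : UnitTangent g → ℝ}
    (W : ∀ ξ : TangentBundle (𝓡 2) M, TangentSpace (𝓡 2).tangent ξ)
    {ξ : TangentBundle (𝓡 2) M} {η : UnitTangent g} {F : Plane × Plane → ℝ}
    (h : η.1.1 ∈ (extChartAt (𝓡 2) ξ.1).source)
    (hF : DifferentiableAt ℝ F (extChartAt (𝓡 2).tangent ξ η.1))
    (hf : radialExt f =ᶠ[𝓝 η.1] F ∘ extChartAt (𝓡 2).tangent ξ) :
    along W f η = fderiv ℝ F (extChartAt (𝓡 2).tangent ξ η.1)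
      (fderivWithin ℝ (extChartAt (𝓡 2).tangent ξ ∘ (extChartAt (𝓡 2).tangent η.1).symm)
        (Set.range (𝓡 2).tangent) (extChartAt (𝓡 2).tangent η.1 η.1) (W η.1)) := by
  have hs := mem_extChartAt_tangent_source.2 h
  rw [extChartAt_source] at hs
  have : IsManifold (𝓡 2).tangent ∞ (TangentBundle (𝓡 2) M) := inferInstance
  have : IsManifold (𝓡 2).tangent 1 (TangentBundle (𝓡 2) M) := .of_le (n := ∞) (by simp)
  have h1 := (hF.hasFDerivAt.hasMFDerivAt.comp η.1
    (hasMFDerivAt_extChartAt (I := (𝓡 2).tangent) hs)).congr_of_eventuallyEq hf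
  have h2 : along W f η = mfderiv (𝓡 2).tangent 𝓘(ℝ, ℝ) (radialExt f) η.1 (W η.1) := rfl
  rw [h2, h1.mfderiv, mfderiv_chartAt_eq_tangentCoordChange hs]
  rfl

theorem along_eq_self {g : RiemMetric M} {f : UnitTangent g → ℝ}
    (W : ∀ ξ : TangentBundle (𝓡 2) M, TangentSpace (𝓡 2).tangent ξ)
    {η : UnitTangent g} {F : Plane × Plane → ℝ}
    (hF : DifferentiableAt ℝ F (extChartAt (𝓡 2).tangent η.1 η.1))
    (hf : radialExt f =ᶠ[𝓝 η.1] F ∘ extChartAt (𝓡 2).tangent η.1) :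
    along W f η = fderiv ℝ F (extChartAt (𝓡 2) η.1.1 η.1.1, η.1.2) (W η.1) := by
  refine (along_eq W (mem_extChartAt_source _) hF hf).trans ?_
  have h : tangentCoordChange (𝓡 2).tangent η.1 η.1 η.1 (W η.1) = W η.1 :=
    tangentCoordChange_self (mem_extChartAt_source _)
  exact (congrArg (fderiv ℝ F (extChartAt (𝓡 2).tangent η.1 η.1)) h).trans
    (congrArg (fun q => fderiv ℝ F q (W η.1)) (extChartAt_tangent_self η.1))

/-! ### The functions `u` and `θ` in charts -/

/-- `u` splits since, in the oriented `g`-orthonormal frame `v, J v`, the number `p q - r²` is the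
ratio of the determinants of the two metrics, whatever `v` is. -/
theorem uFun_eq (g gh : RiemMetric M) (η : UnitTangent g) :
    uFun g gh η = 3 / 2 * Real.log (gh.inner η.1.1 η.1.2 η.1.2) -
      Real.log (detForm (gh.inner η.1.1)) + Real.log (detForm (g.inner η.1.1)) := by
  have hs := g.symm η.1.1
  have hdg : 0 < detForm (g.inner η.1.1) := detForm_pos hs (g.pos η.1.1)
  have hdh : 0 < detForm (gh.inner η.1.1) := detForm_pos (gh.symm η.1.1) (gh.pos η.1.1)
  have hp : 0 < pFun g gh η := gh.pos η.1.1 η.1.2 (unit_ne_zero η)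
  have hw : √(detForm (g.inner η.1.1)) * wedge η.1.2 (rotForm (g.inner η.1.1) η.1.2) = 1 :=
    (wedge_rotForm hs (g.pos η.1.1) η.1.2 η.1.2).trans η.2
  have hgram : pFun g gh η * qFun g gh η - rFun g gh η ^ 2 =
      wedge η.1.2 (rotForm (g.inner η.1.1) η.1.2) ^ 2 * detForm (gh.inner η.1.1) :=
    form_gram (gh.symm η.1.1) η.1.2 (rotForm (g.inner η.1.1) η.1.2)
  change uFun g gh η = 3 / 2 * Real.log (pFun g gh η) -
      Real.log (detForm (gh.inner η.1.1)) + Real.log (detForm (g.inner η.1.1))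
  rw [uFun]
  generalize pFun g gh η = P at *
  generalize detForm (g.inner η.1.1) = d at *
  generalize detForm (gh.inner η.1.1) = d' at *
  generalize wedge η.1.2 (rotForm (g.inner η.1.1) η.1.2) = s at *
  have hw2 : s ^ 2 = d⁻¹ := by
    refine eq_inv_of_mul_eq_one_left ?_
    rw [← Real.sq_sqrt hdg.le, ← mul_pow, mul_comm, hw, one_pow]
  have hq : 0 < d⁻¹ * d' := mul_pos (inv_pos.2 hdg) hdh
  rw [hgram, hw2, Real.log_div hp.ne' (Real.rpow_pos_of_pos hq _).ne', Real.log_rpow hq,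
    Real.log_mul (inv_pos.2 hdg).ne' hdh.ne', Real.log_inv]
  ring

theorem radialExt_of_ne {g : RiemMetric M} (f : UnitTangent g → ℝ) {ζ : TangentBundle (𝓡 2) M}
    (hζ : ζ.2 ≠ 0) : radialExt f ζ = f (toUnit g ζ hζ) := dif_neg hζ

/-- The local formula for `u` holds in every chart: a change of chart multiplies both determinants
by the same factor. -/
theorem radialExt_uFun (g gh : RiemMetric M) {ξ ζ : TangentBundle (𝓡 2) M}
    (h : ζ.1 ∈ (extChartAt (𝓡 2) ξ.1).source) (hζ : ζ.2 ≠ 0) :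
    radialExt (uFun g gh) ζ =
      uLocal (metricLocal gh ξ.1) (metricLocal g ξ.1) (extChartAt (𝓡 2).tangent ξ ζ) := by
  rw [radialExt_of_ne _ hζ, uFun_eq]
  obtain ⟨y, v⟩ := ζ
  have hg0 := g.pos y v hζ
  have hh0 := gh.pos y v hζ
  have hp := (extChartAt (𝓡 2) ξ.1).map_source h
  have hd (g : RiemMetric M) : Real.log (detForm (g.inner y)) =
      Real.log (wedge (tangentCoordChange (𝓡 2) y ξ.1 y (stdVec 0))
        (tangentCoordChange (𝓡 2) y ξ.1 y (stdVec 1)) ^ 2) +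
      Real.log (detForm (metricLocal g ξ.1 (extChartAt (𝓡 2) ξ.1 y))) := by
    have h1 : detForm (g.inner y) = _ :=
      detForm_pullback (metricLocal_symm g ξ.1 (extChartAt (𝓡 2) ξ.1 y))
        (inner_eq_metricLocal g ξ.1 h)
    have h2 : 0 < detForm (g.inner y) := detForm_pos (g.symm y) (g.pos y)
    rw [h1] at h2 ⊢
    exact Real.log_mul (left_ne_zero_of_mul h2.ne') (right_ne_zero_of_mul h2.ne')
  have hn : gh.inner y ((√(g.inner y v v))⁻¹ • v) ((√(g.inner y v v))⁻¹ • v) =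
      gh.inner y v v / g.inner y v v := by
    simp only [map_smul, smul_apply, smul_eq_mul]
    rw [← mul_assoc, ← mul_inv, Real.mul_self_sqrt hg0.le, inv_mul_eq_div]
  have e1 : gh.inner (toUnit g ⟨y, v⟩ hζ).1.1 (toUnit g ⟨y, v⟩ hζ).1.2 (toUnit g ⟨y, v⟩ hζ).1.2 =
      gh.inner y v v / g.inner y v v := hn
  have e2 : detForm (gh.inner (toUnit g ⟨y, v⟩ hζ).1.1) = detForm (gh.inner y) := rfl
  have e3 : detForm (g.inner (toUnit g ⟨y, v⟩ hζ).1.1) = detForm (g.inner y) := rfl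
  rw [e1, e2, e3, hd g, hd gh, Real.log_div hh0.ne' hg0.ne', uLocal,
    inner_eq_metricLocal g ξ.1 h, inner_eq_metricLocal gh ξ.1 h]
  simp only [extChartAt_tangent]
  ring

theorem contDiffAt_uLocal_chart (g gh : RiemMetric M) (ξ : TangentBundle (𝓡 2) M) (hξ : ξ.2 ≠ 0) :
    ContDiffAt ℝ ∞ (uLocal (metricLocal gh ξ.1) (metricLocal g ξ.1))
      (extChartAt (𝓡 2).tangent ξ ξ) := by
  have hx := mem_extChartAt_target (I := 𝓡 2) ξ.1
  rw [extChartAt_tangent_self]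
  exact contDiffAt_uLocal (contDiffAt_metricLocal gh hx) (contDiffAt_metricLocal g hx)
    (metricLocal_symm gh ξ.1 _) (metricLocal_symm g ξ.1 _) (metricLocal_pos gh hx)
    (metricLocal_pos g hx) hξ

theorem isSmooth_uFun (g gh : RiemMetric M) : IsSmooth (uFun g gh) :=
  isSmooth_of_chart (fun ξ => uLocal (metricLocal gh ξ.1) (metricLocal g ξ.1))
    (contDiffAt_uLocal_chart g gh) fun _ _ h hζ => radialExt_uFun g gh h hζ

theorem along_uFun (g gh : RiemMetric M)
    (W : ∀ ξ : TangentBundle (𝓡 2) M, TangentSpace (𝓡 2).tangent ξ) (η : UnitTangent g) :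
    along W (uFun g gh) η = fderiv ℝ (uLocal (metricLocal gh η.1.1) (metricLocal g η.1.1))
      (extChartAt (𝓡 2) η.1.1 η.1.1, η.1.2) (W η.1) := by
  refine along_eq_self W
    ((contDiffAt_uLocal_chart g gh η.1 (unit_ne_zero η)).differentiableAt (by simp)) ?_
  filter_upwards [eventually_snd_ne_zero (unit_ne_zero η)] with ζ hζ
  exact radialExt_uFun g gh hζ.1 hζ.2

/-- Normalisation of tangent vectors in a chart. -/
theorem toUnit_chart (g : RiemMetric M) {ξ ζ : TangentBundle (𝓡 2) M}
    (h : ζ.1 ∈ (extChartAt (𝓡 2) ξ.1).source) (hζ : ζ.2 ≠ 0) :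
    extChartAt (𝓡 2).tangent ξ (toUnit g ζ hζ).1 = ((extChartAt (𝓡 2).tangent ξ ζ).1,
      (√(metricLocal g ξ.1 (extChartAt (𝓡 2).tangent ξ ζ).1 (extChartAt (𝓡 2).tangent ξ ζ).2
        (extChartAt (𝓡 2).tangent ξ ζ).2))⁻¹ • (extChartAt (𝓡 2).tangent ξ ζ).2) := by
  refine Prod.ext rfl ?_
  have h1 : g.inner ζ.1 ζ.2 ζ.2 = metricLocal g ξ.1 (extChartAt (𝓡 2).tangent ξ ζ).1
      (extChartAt (𝓡 2).tangent ξ ζ).2 (extChartAt (𝓡 2).tangent ξ ζ).2 :=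
    inner_eq_metricLocal g ξ.1 h ζ.2 ζ.2
  rw [← h1]
  exact (tangentCoordChange (𝓡 2) ζ.1 ξ.1 ζ.1).map_smul _ ζ.2

/-- A one-form in coordinates, extended to be constant along rays. -/
def formRadial (k : Plane → Plane →L[ℝ] Plane →L[ℝ] ℝ) (a : Plane → Plane →L[ℝ] ℝ)
    (q : Plane × Plane) : ℝ := (√(k q.1 q.2 q.2))⁻¹ * a q.1 q.2

theorem radialExt_formFun (g : RiemMetric M) (θ : OneForm M) {ξ ζ : TangentBundle (𝓡 2) M}
    (h : ζ.1 ∈ (extChartAt (𝓡 2) ξ.1).source) (hζ : ζ.2 ≠ 0) :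
    radialExt (formFun g θ) ζ =
      formRadial (metricLocal g ξ.1) (formLocal θ ξ.1) (extChartAt (𝓡 2).tangent ξ ζ) := by
  have h1 := toUnit_chart g h hζ
  have h2 : formFun g θ (toUnit g ζ hζ) = formLocal θ ξ.1
      (extChartAt (𝓡 2).tangent ξ (toUnit g ζ hζ).1).1
      (extChartAt (𝓡 2).tangent ξ (toUnit g ζ hζ).1).2 :=
    form_eq_formLocal θ ξ.1 (z := (toUnit g ζ hζ).1.1) h _
  rw [radialExt_of_ne _ hζ, h2, h1, formRadial, map_smul, smul_eq_mul]

theorem contDiffAt_invNorm {k : Plane → Plane →L[ℝ] Plane →L[ℝ] ℝ} {p v : Plane}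
    (hk : ContDiffAt ℝ ∞ k p) (hp : ∀ v, v ≠ 0 → 0 < k p v v) (hv : v ≠ 0) :
    ContDiffAt ℝ ∞ (fun q : Plane × Plane => (√(k q.1 q.2 q.2))⁻¹) (p, v) := by
  have hk1 : ContDiffAt ℝ ∞ (fun q : Plane × Plane => k q.1) (p, v) := hk.comp (p, v) contDiffAt_fst
  have hv1 : ContDiffAt ℝ ∞ (fun q : Plane × Plane => q.2) (p, v) := contDiffAt_snd
  exact (((hk1.clm_apply hv1).clm_apply hv1).sqrt (hp v hv).ne').inv
    (Real.sqrt_pos.2 (hp v hv)).ne'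

theorem fderiv_formRadial {k : Plane → Plane →L[ℝ] Plane →L[ℝ] ℝ} {a : Plane → Plane →L[ℝ] ℝ}
    {p v w : Plane} (hk : ContDiffAt ℝ ∞ k p) (ha : ContDiffAt ℝ ∞ a p)
    (hs : ∀ v w, k p v w = k p w v)
    (hp : ∀ v, v ≠ 0 → 0 < k p v v) (hv : k p v v = 1) (hw : k p v w = 0) :
    DifferentiableAt ℝ (formRadial k a) (p, v) ∧
      fderiv ℝ (formRadial k a) (p, v) (0, w) = a p w := by
  have hv0 : v ≠ 0 := fun h0 => by simp [h0] at hv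
  have ha1 : ContDiffAt ℝ ∞ (fun q : Plane × Plane => a q.1) (p, v) := ha.comp (p, v) contDiffAt_fst
  have hd : DifferentiableAt ℝ (formRadial k a) (p, v) :=
    ((contDiffAt_invNorm hk hp hv0).mul (ha1.clm_apply contDiffAt_snd)).differentiableAt (by simp)
  refine ⟨hd, ?_⟩
  have hw1 : HasDerivAt (fun s : ℝ => v + s • w) w 0 := by
    simpa using ((hasDerivAt_id (0 : ℝ)).smul_const w).const_add v
  have hl : HasDerivAt (fun s : ℝ => ((p, v + s • w) : Plane × Plane)) (0, w) 0 :=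
    (hasDerivAt_const 0 p).prodMk hw1
  have h2 := HasFDerivAt.comp_hasDerivAt (0 : ℝ) (l := formRadial k a)
    (by simpa using hd.hasFDerivAt) hl
  have h3 := (((k p).hasFDerivAt.comp_hasDerivAt 0 hw1).clm_apply hw1).sqrt
    (by simp [hv])
  have h4 := (h3.fun_inv (by simp [hv])).mul ((a p).hasFDerivAt.comp_hasDerivAt 0 hw1)
  rw [h2.unique h4]
  simp [hv, hw, hs w v]

/-! ### The vertical vector field in charts -/

omit [IsManifold (𝓡 2) ∞ M] in
theorem det_fderiv_trans_pos [IsOrientedSurface M] {x y z : M}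
    (hx : z ∈ (extChartAt (𝓡 2) x).source) (hy : z ∈ (extChartAt (𝓡 2) y).source) :
    0 < (fderiv ℝ (trans x y) (extChartAt (𝓡 2) x z)).det := by
  rw [extChartAt_source] at hx hy
  refine IsOrientedSurface.det_pos _ (chart_mem_atlas Plane x) _ (chart_mem_atlas Plane y)
    (chartAt Plane x z) ?_
  rw [OpenPartialHomeomorph.trans_source, OpenPartialHomeomorph.symm_source]
  refine ⟨(chartAt Plane x).map_source hx, ?_⟩
  rw [Set.mem_preimage, (chartAt Plane x).left_inv hx]
  exact hy

/-- In every chart of the atlas `J` is given by the coefficients of `g` in this chart. The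
orientation enters here. -/
theorem rot_chart [IsOrientedSurface M] (g : RiemMetric M) {x y : M}
    (h : y ∈ (extChartAt (𝓡 2) x).source) (v : TangentSpace (𝓡 2) y) :
    tangentCoordChange (𝓡 2) y x y (rot g y v) =
      rotForm (metricLocal g x (extChartAt (𝓡 2) x y)) (tangentCoordChange (𝓡 2) y x y v) := by
  have hy := mem_extChartAt_source (I := 𝓡 2) y
  refine rotForm_pullback (metricLocal_symm g x _)
    (metricLocal_pos g ((extChartAt (𝓡 2) x).map_source h)) (inner_eq_metricLocal g x h)
    (g.pos y) ?_ ?_ v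
  · rw [tangentCoordChange_eq]
    exact det_fderiv_trans_pos hy h
  · rw [tangentCoordChange_eq]
    exact surjective_fderiv_trans hy h

/-- `V f` in a chart of the tangent bundle. -/
theorem vert_chart [IsOrientedSurface M] {g : RiemMetric M} {f : UnitTangent g → ℝ}
    (hf : IsSmooth f) {ξ : TangentBundle (𝓡 2) M} {η : UnitTangent g}
    (h : η.1.1 ∈ (extChartAt (𝓡 2) ξ.1).source) :
    vert f η = fderiv ℝ (inChart f ξ) (extChartAt (𝓡 2).tangent ξ η.1)
      (0, rotForm (metricLocal g ξ.1 (extChartAt (𝓡 2).tangent ξ η.1).1)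
        (extChartAt (𝓡 2).tangent ξ η.1).2) := by
  have hd := (contDiffAt_inChart hf h (unit_ne_zero η)).differentiableAt (by simp)
  have he : radialExt f =ᶠ[𝓝 η.1] inChart f ξ ∘ extChartAt (𝓡 2).tangent ξ := by
    filter_upwards [(isOpen_extChartAt_source (I := (𝓡 2).tangent) ξ).mem_nhds
      (mem_extChartAt_tangent_source.2 h)] with ζ hζ
    exact radialExt_eq_inChart f (mem_extChartAt_tangent_source.1 hζ)
  refine (along_eq (verticalField g) h hd he).trans ?_
  have h1 := tangent_trans_apply (ξ := η.1) h 0 (rot g η.1.1 η.1.2)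
  have h2 := rot_chart g h η.1.2
  refine congrArg _ (h1.trans ?_)
  rw [map_zero, map_zero, ← tangentCoordChange_eq]
  exact Prod.ext rfl ((add_zero _).trans h2)

set_option maxSynthPendingDepth 3 in
theorem contDiffAt_rotForm {k : Plane → Plane →L[ℝ] Plane →L[ℝ] ℝ} {p v : Plane}
    (hk : ContDiffAt ℝ ∞ k p) (hs : ∀ v w, k p v w = k p w v)
    (hp : ∀ v, v ≠ 0 → 0 < k p v v) :
    ContDiffAt ℝ ∞ (fun q : Plane × Plane => rotForm (k q.1) q.2) (p, v) := by
  have hk1 : ContDiffAt ℝ ∞ (fun q : Plane × Plane => k q.1) (p, v) := hk.comp (p, v) contDiffAt_fst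
  have he (i j : Fin 2) : ContDiffAt ℝ ∞ (fun q : Plane × Plane => k q.1 (stdVec i) (stdVec j))
      (p, v) := (hk1.clm_apply contDiffAt_const).clm_apply contDiffAt_const
  have hd : ContDiffAt ℝ ∞ (fun q : Plane × Plane => (√(detForm (k q.1)))⁻¹) (p, v) :=
    ((((he 0 0).mul (he 1 1)).sub ((he 0 1).pow 2)).sqrt (detForm_pos hs hp).ne').inv
      (Real.sqrt_pos.2 (detForm_pos hs hp)).ne'
  have hc (i : Fin 2) : ContDiffAt ℝ ∞ (fun q : Plane × Plane => q.2 i) (p, v) :=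
    (EuclideanSpace.proj (𝕜 := ℝ) i).contDiff.contDiffAt.comp (p, v) contDiffAt_snd
  exact hd.smul (((((he 0 1).mul (hc 0)).add ((he 1 1).mul (hc 1))).neg.smul contDiffAt_const).add
    ((((he 0 0).mul (hc 0)).add ((he 0 1).mul (hc 1))).smul contDiffAt_const))

/-- `V` maps smooth functions on `SM` to smooth functions. -/
theorem isSmooth_vert [IsOrientedSurface M] {g : RiemMetric M} {f : UnitTangent g → ℝ}
    (hf : IsSmooth f) : IsSmooth (vert f) := by
  refine isSmooth_of_chart (fun ξ q => fderiv ℝ (inChart f ξ)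
    (q.1, (√(metricLocal g ξ.1 q.1 q.2 q.2))⁻¹ • q.2)
    (0, rotForm (metricLocal g ξ.1 q.1) ((√(metricLocal g ξ.1 q.1 q.2 q.2))⁻¹ • q.2))) ?_ ?_
  · intro ξ hξ
    have hx := mem_extChartAt_target (I := 𝓡 2) ξ.1
    have hk := contDiffAt_metricLocal g hx
    have hp := metricLocal_pos g hx
    have hn : ContDiffAt ℝ ∞ (fun q : Plane × Plane =>
        ((q.1, (√(metricLocal g ξ.1 q.1 q.2 q.2))⁻¹ • q.2) : Plane × Plane))
        (extChartAt (𝓡 2) ξ.1 ξ.1, ξ.2) :=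
      contDiffAt_fst.prodMk ((contDiffAt_invNorm hk hp hξ).smul contDiffAt_snd)
    have h1 := contDiffAt_inChart hf (ξ := ξ) (ζ := (toUnit g ξ hξ).1)
      (mem_extChartAt_source ξ.1) (unit_ne_zero (toUnit g ξ hξ))
    rw [toUnit_chart g (mem_extChartAt_source ξ.1) hξ, extChartAt_tangent_self] at h1
    rw [extChartAt_tangent_self]
    have h2 := (h1.fderiv_right (m := ∞) (by simp)).comp
      ((extChartAt (𝓡 2) ξ.1 ξ.1, ξ.2) : Plane × Plane) hn
    have h3 := (contDiffAt_rotForm (v := (√(metricLocal g ξ.1 (extChartAt (𝓡 2) ξ.1 ξ.1) ξ.2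
      ξ.2))⁻¹ • ξ.2) hk (metricLocal_symm g ξ.1 _) hp).comp
      ((extChartAt (𝓡 2) ξ.1 ξ.1, ξ.2) : Plane × Plane) hn
    exact h2.clm_apply (contDiffAt_const.prodMk h3)
  · intro ξ ζ h hζ
    rw [radialExt_of_ne _ hζ, vert_chart hf (ξ := ξ) (η := toUnit g ζ hζ) h,
      toUnit_chart g h hζ]

/-- `V θ = θ ∘ J`. -/
theorem vert_formFun (g : RiemMetric M) (θ : OneForm M) (η : UnitTangent g) :
    vert (formFun g θ) η = θ η.1.1 (rot g η.1.1 η.1.2) := by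
  have hx := mem_extChartAt_target (I := 𝓡 2) η.1.1
  have hB : metricLocal g η.1.1 (extChartAt (𝓡 2) η.1.1 η.1.1) η.1.2 η.1.2 = 1 := by
    rw [metricLocal_self]; exact η.2
  have hJ : metricLocal g η.1.1 (extChartAt (𝓡 2) η.1.1 η.1.1) η.1.2 (rot g η.1.1 η.1.2) = 0 := by
    rw [metricLocal_self]; exact form_rotForm_self (g.symm η.1.1) (g.pos η.1.1) η.1.2
  obtain ⟨h1, h2⟩ := fderiv_formRadial (contDiffAt_metricLocal g hx) (contDiffAt_formLocal θ hx)
    (metricLocal_symm g η.1.1 _) (metricLocal_pos g hx) hB hJ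
  refine (along_eq_self (verticalField g) (η := η)
    (F := formRadial (metricLocal g η.1.1) (formLocal θ η.1.1)) ?_ ?_).trans (h2.trans ?_)
  · have := extChartAt_tangent_self η.1
    exact this ▸ h1
  · filter_upwards [eventually_snd_ne_zero (unit_ne_zero η)] with ζ hζ
    exact radialExt_formFun g θ hζ.1 hζ.2
  · rw [formLocal_self]
    rfl

/-- The unit vector `cos t • v + sin t • J v`. -/
def circlePoint (g : RiemMetric M) (x : M) (v : TangentSpace (𝓡 2) x) (hv : g.inner x v v = 1)
    (t : ℝ) : UnitTangent g :=
  ⟨⟨x, Real.cos t • v + Real.sin t • rot g x v⟩, by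
    have h1 : g.inner x v (rot g x v) = 0 := form_rotForm_self (g.symm x) (g.pos x) v
    have h2 : g.inner x (rot g x v) (rot g x v) = 1 :=
      (form_rotForm_rotForm (g.symm x) (g.pos x) v v).trans hv
    simp only [map_add, map_smul, add_apply, smul_apply, smul_eq_mul, hv, h1, h2,
      g.symm x (rot g x v) v]
    linear_combination Real.sin_sq_add_cos_sq t⟩

theorem extChartAt_tangent_fiber (x : M) (v w : TangentSpace (𝓡 2) x) :
    extChartAt (𝓡 2).tangent (⟨x, v⟩ : TangentBundle (𝓡 2) M) ⟨x, w⟩ =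
      (extChartAt (𝓡 2) x x, w) :=
  extChartAt_tangent_self (⟨x, w⟩ : TangentBundle (𝓡 2) M)

/-- `V` is the generator of the rotations of the fibres of `SM`. -/
theorem hasDerivAt_circlePoint [IsOrientedSurface M] {g : RiemMetric M} {f : UnitTangent g → ℝ}
    (hf : IsSmooth f) {x : M} {v : TangentSpace (𝓡 2) x} (hv : g.inner x v v = 1) (t : ℝ) :
    HasDerivAt (fun s => f (circlePoint g x v hv s)) (vert f (circlePoint g x v hv t)) t := by
  have hx (s : ℝ) : (circlePoint g x v hv s).1.1 ∈ (extChartAt (𝓡 2) x).source :=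
    mem_extChartAt_source x
  have hchart (s : ℝ) : extChartAt (𝓡 2).tangent (⟨x, v⟩ : TangentBundle (𝓡 2) M)
      (circlePoint g x v hv s).1 =
      (extChartAt (𝓡 2) x x, Real.cos s • (show Plane from v) +
        Real.sin s • rotForm (g.inner x) v) :=
    extChartAt_tangent_fiber x v _
  have h1 (s : ℝ) : f (circlePoint g x v hv s) = inChart f (⟨x, v⟩ : TangentBundle (𝓡 2) M)
      (extChartAt (𝓡 2) x x, Real.cos s • (show Plane from v) +
        Real.sin s • rotForm (g.inner x) v) := by
    rw [← radialExt_unit f, radialExt_eq_inChart f (ξ := ⟨x, v⟩) (hx s), hchart]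
  have h2 := vert_chart hf (ξ := ⟨x, v⟩) (hx t)
  have h3 := (contDiffAt_inChart hf (ξ := ⟨x, v⟩) (hx t)
    (unit_ne_zero (circlePoint g x v hv t))).differentiableAt (by simp)
  rw [hchart] at h2 h3
  have h4 : HasDerivAt (fun s : ℝ => Real.cos s • (show Plane from v) +
      Real.sin s • rotForm (g.inner x) v) (rotForm (g.inner x)
        (Real.cos t • (show Plane from v) + Real.sin t • rotForm (g.inner x) v)) t := by
    have hJJ : rotForm (g.inner x) (rotForm (g.inner x) v) = -(show Plane from v) :=
      rotForm_rotForm (g.symm x) (g.pos x) v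
    refine (((Real.hasDerivAt_cos t).smul_const (show Plane from v)).add
      ((Real.hasDerivAt_sin t).smul_const (rotForm (g.inner x) v))).congr_deriv ?_
    rw [map_add, map_smul, map_smul, hJJ]
    module
  have h5 := h3.hasFDerivAt.comp_hasDerivAt t
    ((hasDerivAt_const t (extChartAt (𝓡 2) x x)).prodMk h4)
  refine (h5.congr_of_eventuallyEq (.of_forall h1)).congr_deriv ?_
  rw [h2, metricLocal_self]

/-! ### The transport equation -/

theorem inner_neg_self {g : RiemMetric M} {x : M} {v : TangentSpace (𝓡 2) x}
    (hv : g.inner x v v = 1) : g.inner x (-v) (-v) = 1 := by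
  simpa using hv

theorem circlePoint_zero {g : RiemMetric M} {x : M} {v : TangentSpace (𝓡 2) x}
    (hv : g.inner x v v = 1) : circlePoint g x v hv 0 = ⟨⟨x, v⟩, hv⟩ := by
  apply Subtype.ext
  change (⟨x, _⟩ : TangentBundle (𝓡 2) M) = ⟨x, v⟩
  rw [Real.cos_zero, Real.sin_zero, one_smul, zero_smul, add_zero]

theorem circlePoint_pi {g : RiemMetric M} {x : M} {v : TangentSpace (𝓡 2) x}
    (hv : g.inner x v v = 1) : circlePoint g x v hv Real.pi = ⟨⟨x, -v⟩, inner_neg_self hv⟩ := by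
  apply Subtype.ext
  change (⟨x, _⟩ : TangentBundle (𝓡 2) M) = ⟨x, -v⟩
  rw [Real.cos_pi, Real.sin_pi, neg_one_smul, zero_smul, add_zero]

/-- Functions representing cubic differentials are odd. -/
theorem cubic_neg [IsOrientedSurface M] {g : RiemMetric M} {a : UnitTangent g → ℝ}
    (ha : IsSmooth a) (ha3 : ∀ ξ, 9 * a ξ + vert (vert a) ξ = 0) {x : M}
    {v : TangentSpace (𝓡 2) x} (hv : g.inner x v v = 1) :
    a ⟨⟨x, -v⟩, inner_neg_self hv⟩ = -a ⟨⟨x, v⟩, hv⟩ := by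
  have h := antiperiodic_of_deriv_deriv (hasDerivAt_circlePoint ha hv) (fun t => by
    refine (hasDerivAt_circlePoint (isSmooth_vert ha) hv t).congr_deriv ?_
    linear_combination ha3 (circlePoint g x v hv t)) 0
  rwa [zero_add, circlePoint_pi, circlePoint_zero] at h

set_option maxSynthPendingDepth 3 in
/-- If `w = c v` and `v` are unit vectors at which the curve of geodesic curvature `l` and the
geodesic of the Weyl connection have proportional velocities and compatible accelerations, then `l`
is, up to the sign `c`, the normal component of the difference of the sprays at `v`. -/
theorem curvature_of_acceleration {h k : Plane → Plane →L[ℝ] Plane →L[ℝ] ℝ}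
    {a : Plane → Plane →L[ℝ] ℝ} {p v w : Plane} {c d l : ℝ} (hs : ∀ v w, k p v w = k p w v)
    (hp : ∀ v, v ≠ 0 → 0 < k p v v) (hv : k p v v = 1) (hw : k p w w = 1) (hwc : w = c • v)
    (hacc : -christoffelLocal k p w w + l • rotForm (k p) w =
      d • v - c ^ 2 • weylLocal h a p v) :
    (c = 1 ∨ c = -1) ∧ c * l = k p (sprayDiff h k a p v v) (rotForm (k p) v) := by
  subst hwc
  simp only [map_smul, smul_apply, smul_eq_mul, hv, mul_one] at hw
  have hc2 : c ^ 2 = 1 := by rw [sq]; exact hw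
  have hJ := form_rotForm_self hs hp v
  have hJJ := (form_rotForm_rotForm hs hp v v).trans hv
  refine ⟨mul_self_eq_one_iff.1 hw, ?_⟩
  have e : christoffelLocal k p (c • v) (c • v) = christoffelLocal k p v v := by
    rw [← raise_eq_christoffelLocal, map_smul, map_smul, smul_apply, smul_smul, hw, one_smul,
      raise_eq_christoffelLocal]
  rw [e, hc2, one_smul, map_smul, smul_smul, mul_comm l] at hacc
  have h1 : sprayDiff h k a p v v = (c * l) • rotForm (k p) v - d • v := by
    rw [sprayDiff_self]
    rw [sub_eq_sub_iff_add_eq_add]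
    rw [neg_add_eq_iff_eq_add] at hacc
    rw [hacc]
    abel
  rw [h1, map_sub, map_smul, map_smul, sub_apply, smul_apply, smul_apply, hJ, hJJ]
  simp

/-- If the thermostat and the Weyl connection have the same unparametrised geodesics, then
`l = a - V θ` is the normal component of the difference of the sprays. Orbits may run through the
geodesic of `v` in the direction `-v`; this is harmless since `l` is odd. -/
theorem curvature_eq [IsOrientedSurface M] {g gh : RiemMetric M} {θ α : OneForm M}
    {a : UnitTangent g → ℝ} (ha : IsSmooth a) (ha3 : ∀ ξ, 9 * a ξ + vert (vert a) ξ = 0)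
    (hgeo : SameUnparametrisedGeodesics g (a - vert (formFun g θ)) (weylConnection gh α))
    {x : M} {v : TangentSpace (𝓡 2) x} (hv : g.inner x v v = 1) :
    a ⟨⟨x, v⟩, hv⟩ - θ x (rot g x v) =
      metricLocal g x (extChartAt (𝓡 2) x x)
        (sprayDiff (metricLocal gh x) (metricLocal g x) (formLocal α x) (extChartAt (𝓡 2) x x) v v)
        (rotForm (metricLocal g x (extChartAt (𝓡 2) x x)) v) := by
  have hv0 : v ≠ 0 := fun h => by simp [h] at hv
  obtain ⟨w, hw, c, d, hwc, hacc⟩ := exists_acceleration_eq hgeo x v hv0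
  have hrot (w : TangentSpace (𝓡 2) x) :
      (show Plane from rot g x w) = rotForm (metricLocal g x (extChartAt (𝓡 2) x x)) w := by
    rw [metricLocal_self]; rfl
  have hunit {w : TangentSpace (𝓡 2) x} (hw : g.inner x w w = 1) :
      metricLocal g x (extChartAt (𝓡 2) x x) w w = 1 := by rw [metricLocal_self]; exact hw
  rw [hrot] at hacc
  obtain ⟨hc, h1⟩ := curvature_of_acceleration (metricLocal_symm g x _)
    (metricLocal_pos g (mem_extChartAt_target (I := 𝓡 2) x)) (hunit hv) (hunit hw) hwc hacc
  refine Eq.trans ?_ h1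
  have hl : (a - vert (formFun g θ)) ⟨⟨x, w⟩, hw⟩ = a ⟨⟨x, w⟩, hw⟩ - θ x (rot g x w) :=
    congrArg (a ⟨⟨x, w⟩, hw⟩ - ·) (vert_formFun g θ ⟨⟨x, w⟩, hw⟩)
  rw [hl]
  rcases hc with rfl | rfl
  · obtain rfl : w = v := hwc.trans (one_smul ℝ v)
    rw [one_mul]
  · obtain rfl : w = -v := hwc.trans (neg_one_smul ℝ v)
    have h2 : rot g x (-v) = -rot g x v := map_neg (rotForm (g.inner x)) v
    have h3 := cubic_neg ha ha3 hv
    rw [h2, map_neg]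
    linear_combination h3

/-- The transport equation at `(x, v)`. -/
theorem transport [IsOrientedSurface M] {g gh : RiemMetric M} {θ α : OneForm M}
    {a : UnitTangent g → ℝ} (ha : IsSmooth a) (ha3 : ∀ ξ, 9 * a ξ + vert (vert a) ξ = 0)
    (hgeo : SameUnparametrisedGeodesics g (a - vert (formFun g θ)) (weylConnection gh α))
    {x : M} {v : TangentSpace (𝓡 2) x} (hv : g.inner x v v = 1) :
    along (thermostatField g (a - vert (formFun g θ))) (uFun g gh) ⟨⟨x, v⟩, hv⟩ =
      vert a ⟨⟨x, v⟩, hv⟩ + (θ x v - α x v) := by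
  have hx := mem_extChartAt_target (I := 𝓡 2) x
  have hB : metricLocal g x (extChartAt (𝓡 2) x x) v v = 1 := by rw [metricLocal_self]; exact hv
  have hrot (w : TangentSpace (𝓡 2) x) :
      (show Plane from rot g x w) = rotForm (metricLocal g x (extChartAt (𝓡 2) x x)) w := by
    rw [metricLocal_self]; rfl
  have hD := hasDerivAt_curvature (a := formLocal α x) (contDiffAt_metricLocal gh hx)
    (contDiffAt_metricLocal g hx) (metricLocal_symm gh x) (metricLocal_symm g x)
    (metricLocal_pos gh hx) (metricLocal_pos g hx) hB
  have hl : (a - vert (formFun g θ)) ⟨⟨x, v⟩, hv⟩ = _ :=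
    (congrArg (a ⟨⟨x, v⟩, hv⟩ - ·) (vert_formFun g θ ⟨⟨x, v⟩, hv⟩)).trans
      (curvature_eq ha ha3 hgeo hv)
  have hF : (show Plane × Plane from thermostatField g (a - vert (formFun g θ)) ⟨x, v⟩) =
      (v, -christoffelLocal (metricLocal g x) (extChartAt (𝓡 2) x x) v v +
        metricLocal g x (extChartAt (𝓡 2) x x)
        (sprayDiff (metricLocal gh x) (metricLocal g x) (formLocal α x) (extChartAt (𝓡 2) x x) v v)
        (rotForm (metricLocal g x (extChartAt (𝓡 2) x x)) v) •
          rotForm (metricLocal g x (extChartAt (𝓡 2) x x)) v) := by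
    refine Prod.ext (thermostatField_fst g _ _) ((thermostatField_snd g _ _).trans ?_)
    have h1 := radialExt_unit (a - vert (formFun g θ)) ⟨⟨x, v⟩, hv⟩
    rw [← hl, ← h1, ← hrot]
  have hu : along (thermostatField g (a - vert (formFun g θ))) (uFun g gh) ⟨⟨x, v⟩, hv⟩ = _ :=
    (along_uFun g gh _ _).trans (congrArg (fderiv ℝ (uLocal (metricLocal gh x) (metricLocal g x))
      (extChartAt (𝓡 2) x x, v)) hF)
  have hJ : HasDerivAt (fun t : ℝ => θ x (rot g x (circlePoint g x v hv t).1.2)) (-θ x v) 0 := by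
    have hJJ : rot g x (rot g x v) = -v := rotForm_rotForm (g.symm x) (g.pos x) v
    have h1 (t : ℝ) : θ x (rot g x (circlePoint g x v hv t).1.2) =
        Real.cos t * θ x (rot g x v) - Real.sin t * θ x v := by
      have h2 : rot g x (circlePoint g x v hv t).1.2 =
          Real.cos t • rot g x v + Real.sin t • -v := by
        rw [← hJJ]
        exact (map_add (rotForm (g.inner x)) _ _).trans
          (congrArg₂ (· + ·) (map_smul (rotForm (g.inner x)) _ _)
            (map_smul (rotForm (g.inner x)) _ _))
      rw [h2, map_add, map_smul, map_smul, map_neg, smul_eq_mul, smul_eq_mul]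
      ring
    exact ((((Real.hasDerivAt_cos 0).mul_const (θ x (rot g x v))).sub
      ((Real.hasDerivAt_sin 0).mul_const (θ x v))).congr_of_eventuallyEq
        (.of_forall h1)).congr_deriv (by simp)
  have h3 := (hasDerivAt_circlePoint ha hv 0).sub hJ
  -- two expressions for `V l`
  have h4 := h3.unique (hD.congr_of_eventuallyEq (.of_forall fun t => ?_))
  · rw [circlePoint_zero, formLocal_self] at h4
    rw [hu]
    have h5 (A T X B : ℝ) (h : A - -T = X + B) : X = A + (T - B) := by linarith
    exact h5 _ _ _ _ h4
  · have h6 := curvature_eq ha ha3 hgeo (circlePoint g x v hv t).2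
    have h7 : (show Plane from (circlePoint g x v hv t).1.2) = Real.cos t • (show Plane from v) +
      Real.sin t • rotForm (metricLocal g x (extChartAt (𝓡 2) x x)) v := by
      rw [metricLocal_self]; rfl
    exact h6.trans (congrArg (fun w : Plane => metricLocal g x (extChartAt (𝓡 2) x x)
      (sprayDiff (metricLocal gh x) (metricLocal g x) (formLocal α x) (extChartAt (𝓡 2) x x) w w)
      (rotForm (metricLocal g x (extChartAt (𝓡 2) x x)) w)) h7)

end Thermostat
end

open Thermostat
theorem corollary5 {M : Type*} [TopologicalSpace M] [T2Space M] [SecondCountableTopology M]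
    [ConnectedSpace M] [ChartedSpace Plane M] [IsManifold (𝓡 2) ∞ M] [IsOrientedSurface M]
    (g gh : RiemMetric M) (θ α : OneForm M) (a : UnitTangent g → ℝ)
    (ha : IsSmooth a) (ha3 : ∀ ξ, 9 * a ξ + vert (vert a) ξ = 0)
    (hgeo : SameUnparametrisedGeodesics g (a - vert (formFun g θ)) (weylConnection gh α)) :
    IsSmooth (uFun g gh) ∧
      ∀ ξ : UnitTangent g,
        along (thermostatField g (a - vert (formFun g θ))) (uFun g gh) ξ =
          vert a ξ + formFun g (θ - α) ξ := by
  exact ⟨isSmooth_uFun g gh, fun ξ => transport ha ha3 hgeo ξ.2⟩
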